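/- Let $P$ be a finite set of processes and $\Sigma'$ a finite alphabet. A \emph{message sequence chart} (MSC) over $P$ and $\Sigma'$ consists of a finite word $w_p$ over $\Sigma'$ for every $p\in P$, at least one of them non-empty, and a set $\lhd$ of message edges between events of distinct processes, where an event is a pair $(p,i)$ with $1\le i\le |w_p|$, its process is $p$ and its label is $\lambda(p,i)=(p,a)$ with $a$ the $i$-th letter of $w_p$. Write $(p,i)\to(p,i+1)$ for the process edges. It is required that ${\to}\cup{\lhd}$ is acyclic, that each event is part of at most one message edge, and that for message edges $(e,f),(e',f')$ from the same process $p$ to the same process $q$ one has $e\to^*e'$ iff $f\to^*f'$. Let ${\le}=({\to}\cup{\lhd})^*$, ${<}=({\to}\cup{\lhd})^+$, let $e\parallel f$ mean that neither $e\le f$ nor $f\le e$, and let ${\prec}={<}\setminus({\to}\cup{\lhd})$. Put $R=\{=,\to,\lhd,\parallel,\to^{-1},\lhd^{-1},\prec,\prec^{-1}\}$ and $\mathrm{Types}=\prod_{\bowtie\in R}2^{P\times\Sigma'}$. The type of an event $e$ of $M$ is $\mathrm{type}_M(e)=(\{\lambda(f)\mid e\bowtie f\})_{\bowtie\in R}\in\mathrm{Types}$.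 For a map $\gamma$ from the events of $M$ to a set $\Gamma$, $(M,\gamma)$ denotes the MSC over $P$ and $\Sigma'\times\Gamma$ obtained from $M$ by replacing the letter $a$ at each event $e$ by $(a,\gamma(e))$. A \emph{communicating finite-state machine} (CFM) over $P$ and a finite alphabet $\Sigma$ consists of a finite set $\mathrm{Msg}$ of messages, for each $p\in P$ a finite set $S_p$ of states with an initial state $\iota_p\in S_p$ and a transition relation $\Delta_p\subseteq S_p\times(\Sigma\cup(\Sigma\times\{!,?\}\times\mathrm{Msg}\times(P\setminus\{p\})))\times S_p$, and a set $\mathrm{Acc}\subseteq\prod_{p}S_p$. A run on an MSC $M$ over $P$ and $\Sigma$ assigns to each event $e$ of each process $p$ a transition in $\Delta_p$ that carries the letter of $e$, such that the first transition of each process starts in its initial state; the target of the transition at $e$ is the source of the transition at $f$ whenever $e\to f$; events on no message edge get internal transitions (those with action in $\Sigma$); and for every message edge $(e,f)$ from process $p$ to process $q$ the transition at $e$ sends to $q$ (action $(a,!,m,q)$) and the transition at $f$ receives from $p$ (action $(b,?,m,p)$) one and the same message $m$. The run is accepting if the tuple of last states ($\iota_p$ for a process without events) is in $\mathrm{Acc}$.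 The language $L(\mathcal A)$ is the set of MSCs on which $\mathcal A$ has an accepting run. \textbf{Theorem.} There is a function $f:\mathbb N\to\mathbb N$ with $f(n)=O(n\log n)$ as $n\to\infty$ such that for every finite set $P$ of processes and every finite alphabet $\Sigma'$ there is a CFM $\mathcal A_{\mathrm{type}}$ over $P$ and $\Sigma'\times\mathrm{Types}$ that has at most $2^{|\Sigma'|\cdot 2^{f(|P|)}}$ states on every process and satisfies $$L(\mathcal A_{\mathrm{type}})=\{(M,\mathrm{type}_M)\mid M\text{ an MSC over }P\text{ and }\Sigma'\}.$$ -/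

import Mathlib

universe u v

/-! ### Message sequence charts -/

/-- Events of a family of words with lengths `len p`: the pairs `(p, i)` with `i` a position of the
word of process `p`. Positions are counted from `0`. -/
abbrev EventOf {P : Type u} (len : P → ℕ) : Type u := Σ p : P, Fin (len p)

/-- The process-edge relation: `f` is the next event after `e` on the same process. -/
def ProcEdge {P : Type u} (len : P → ℕ) (e f : EventOf len) : Prop :=
  e.1 = f.1 ∧ (e.2 : ℕ) + 1 = (f.2 : ℕ)

/-- Message sequence charts over a set `P` of processes and an alphabet `A`. The word of process `p`
has length `len p` and letters `letter p 0, letter p 1, …`; `msg` is the set of message edges. -/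
structure MSC (P : Type u) (A : Type v) where
  len : P → ℕ
  letter : ∀ p, Fin (len p) → A
  msg : EventOf len → EventOf len → Prop
  /-- At least one of the words is non-empty. -/
  exists_event : ∃ p, 0 < len p
  /-- Message edges connect distinct processes. -/
  msg_ne : ∀ e f, msg e f → e.1 ≠ f.1
  /-- The union of process edges and message edges is acyclic. -/
  acyclic : ∀ e, ¬ Relation.TransGen (fun x y => ProcEdge len x y ∨ msg x y) e e
  /-- Each event is part of at most one message edge. -/
  msg_unique : ∀ e f e' f', msg e f → msg e' f' → (e = e' ∨ e = f' ∨ f = e' ∨ f = f') →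
    e = e' ∧ f = f'
  /-- Channels are first-in first-out. -/
  fifo : ∀ e f e' f', msg e f → msg e' f' → e.1 = e'.1 → f.1 = f'.1 →
    (Relation.ReflTransGen (ProcEdge len) e e' ↔ Relation.ReflTransGen (ProcEdge len) f f')

namespace MSC

variable {P : Type u} {A : Type v}

/-- The events of an MSC. -/
abbrev Event (M : MSC P A) : Type u := EventOf M.len

/-- The letter of an event. -/
def letterAt (M : MSC P A) (e : M.Event) : A := M.letter e.1 e.2

/-- The labelling by pairs (process, letter). -/
def label (M : MSC P A) (e : M.Event) : P × A := (e.1, M.letterAt e)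

/-- The immediate process successor relation `→`. -/
def proc (M : MSC P A) (e f : M.Event) : Prop := ProcEdge M.len e f

/-- The strict order `<`, the transitive closure of the union of process and message edges. -/
def lt (M : MSC P A) : M.Event → M.Event → Prop :=
  Relation.TransGen (fun x y => M.proc x y ∨ M.msg x y)

/-- The partial order `≤`, the reflexive transitive closure of process and message edges. -/
def le (M : MSC P A) : M.Event → M.Event → Prop :=
  Relation.ReflTransGen (fun x y => M.proc x y ∨ M.msg x y)

/-- Two events are parallel if they are incomparable. -/
def parallel (M : MSC P A) (e f : M.Event) : Prop := ¬ M.le e f ∧ ¬ M.le f e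

/-- The non-immediate strict order: `<` without process edges and message edges. -/
def strictLess (M : MSC P A) (e f : M.Event) : Prop := M.lt e f ∧ ¬ (M.proc e f ∨ M.msg e f)

/-- An event is internal if it belongs to no message edge. -/
def IsInternal (M : MSC P A) (e : M.Event) : Prop := ∀ f, ¬ M.msg e f ∧ ¬ M.msg f e

/-- The extended MSC `(M, γ)`: every letter `a` of `M`, at an event `e`, becomes `(a, γ e)`. -/
def extend {C : Type*} (M : MSC P A) (γ : M.Event → C) : MSC P (A × C) where
  len := M.len
  letter p i := (M.letter p i, γ ⟨p, i⟩)
  msg := M.msg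
  exists_event := M.exists_event
  msg_ne := M.msg_ne
  acyclic := M.acyclic
  msg_unique := M.msg_unique
  fifo := M.fifo

end MSC

/-! ### Types of events -/

/-- The eight relation symbols. -/
inductive RelSymbol : Type
  | eq
  | proc
  | msg
  | parallel
  | procInv
  | msgInv
  | strictLess
  | strictLessInv

/-- Interpretation of the relation symbols in an MSC. -/
def MSC.rel {P : Type u} {A : Type v} (M : MSC P A) : RelSymbol → M.Event → M.Event → Prop
  | .eq => fun e f => e = f
  | .proc => fun e f => M.proc e f
  | .msg => fun e f => M.msg e f
  | .parallel => fun e f => M.parallel e f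
  | .procInv => fun e f => M.proc f e
  | .msgInv => fun e f => M.msg f e
  | .strictLess => fun e f => M.strictLess e f
  | .strictLessInv => fun e f => M.strictLess f e

/-- The set of possible types: a set of (process, letter) pairs for each relation symbol. -/
abbrev Types (P : Type u) (A : Type v) : Type (max u v) := RelSymbol → Set (P × A)

/-- The type of an event: for each relation symbol `r`, the labels of all `f` with `e r f`. -/
def MSC.typeOf {P : Type u} {A : Type v} (M : MSC P A) (e : M.Event) : Types P A :=
  fun r => {l | ∃ f : M.Event, M.rel r e f ∧ M.label f = l}

/-! ### Communicating finite-state machines -/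

/-- Actions of process `p`: internal actions, sends to `q ≠ p` and receives from `q ≠ p`, each
carrying a letter of the alphabet `A`. -/
inductive ProcAction {P : Type u} (A B : Type u) (p : P) : Type u
  | internal (a : A) : ProcAction A B p
  | send (a : A) (m : B) (q : {q : P // q ≠ p}) : ProcAction A B p
  | receive (a : A) (m : B) (q : {q : P // q ≠ p}) : ProcAction A B p

/-- The letter carried by an action. -/
def ProcAction.letter {P A B : Type u} {p : P} : ProcAction A B p → A
  | .internal a => a
  | .send a _ _ => a
  | .receive a _ _ => a

/-- A triple (source state, action, target state). -/
structure Transition (S C : Type u) : Type u where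
  source : S
  action : C
  target : S

/-- Communicating finite-state machines over `P` and `A`. -/
structure CFM (P A : Type u) : Type (u + 1) where
  /-- Message contents. -/
  Message : Type u
  finite_message : Finite Message
  /-- The local states of each process. -/
  State : P → Type u
  finite_state : ∀ p, Finite (State p)
  init : ∀ p, State p
  trans : ∀ p, Set (Transition (State p) (ProcAction A Message p))
  /-- Global accepting states. -/
  acc : Set (∀ p, State p)

namespace CFM

variable {P A : Type u}

/-- Assignments of a transition of the executing process to every event. -/
abbrev Assignment (𝒜 : CFM P A) (M : MSC P A) : Type u :=
  ∀ e : M.Event, Transition (𝒜.State e.1) (ProcAction A 𝒜.Message e.1)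

/-- Runs of a CFM on an MSC. -/
structure IsRun (𝒜 : CFM P A) (M : MSC P A) (ρ : 𝒜.Assignment M) : Prop where
  mem : ∀ e, ρ e ∈ 𝒜.trans e.1
  letter_eq : ∀ e, (ρ e).action.letter = M.letterAt e
  source_first : ∀ p (h : 0 < M.len p), (ρ ⟨p, ⟨0, h⟩⟩).source = 𝒜.init p
  target_eq_source : ∀ p (i j : Fin (M.len p)), M.proc ⟨p, i⟩ ⟨p, j⟩ →
    (ρ ⟨p, i⟩).target = (ρ ⟨p, j⟩).source
  internal : ∀ e, M.IsInternal e → ∃ a, (ρ e).action = .internal a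
  message : ∀ e f (h : M.msg e f), ∃ (m : 𝒜.Message) (a b : A),
    (ρ e).action = .send a m ⟨f.1, (M.msg_ne e f h).symm⟩ ∧
    (ρ f).action = .receive b m ⟨e.1, M.msg_ne e f h⟩

/-- The last local state of process `p`: the target of its last transition, or the initial state if
`p` executes no event. -/
def finalState (𝒜 : CFM P A) (M : MSC P A) (ρ : 𝒜.Assignment M) (p : P) : 𝒜.State p :=
  if h : 0 < M.len p then (ρ ⟨p, ⟨M.len p - 1, Nat.sub_lt h Nat.one_pos⟩⟩).target else 𝒜.init p

/-- The language of a CFM: the MSCs on which it has an accepting run. -/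
def language (𝒜 : CFM P A) : Set (MSC P A) :=
  {M | ∃ ρ : 𝒜.Assignment M, 𝒜.IsRun M ρ ∧ 𝒜.finalState M ρ ∈ 𝒜.acc}

end CFM

/-! ### Neighbours of an event -/

namespace MSC

variable {P : Type u} {A : Type v} (M : MSC P A)

/-- The previous event on the same process. -/
def prev (e : M.Event) : Option M.Event :=
  if _ : 0 < (e.2 : ℕ) then some ⟨e.1, ⟨e.2 - 1, by have := e.2.2; omega⟩⟩ else none

/-- The next event on the same process. -/
def next (e : M.Event) : Option M.Event :=
  if h : (e.2 : ℕ) + 1 < M.len e.1 then some ⟨e.1, ⟨e.2 + 1, h⟩⟩ else none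

open Classical in
/-- The receive event of the message sent by `e`. -/
noncomputable def rcv (e : M.Event) : Option M.Event :=
  if h : ∃ f, M.msg e f then some h.choose else none

open Classical in
/-- The send event of the message received by `e`. -/
noncomputable def snd (e : M.Event) : Option M.Event :=
  if h : ∃ f, M.msg f e then some h.choose else none

/-- The last event of a process. -/
def lastEvent (p : P) : Option M.Event :=
  if h : 0 < M.len p then some ⟨p, ⟨M.len p - 1, Nat.sub_lt h Nat.one_pos⟩⟩ else none

variable {M}

theorem event_ext {e f : M.Event} (h : e.1 = f.1) (h' : (e.2 : ℕ) = f.2) : e = f := by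
  obtain ⟨p, i⟩ := e
  obtain ⟨q, j⟩ := f
  obtain rfl : p = q := h
  obtain rfl : i = j := Fin.ext h'
  rfl

theorem proc_iff {e f : M.Event} : M.proc e f ↔ e.1 = f.1 ∧ (e.2 : ℕ) + 1 = f.2 := Iff.rfl

theorem prev_eq_some {e f : M.Event} : M.prev e = some f ↔ M.proc f e := by
  unfold prev
  split_ifs with h
  · rw [Option.some_inj, proc_iff]
    constructor
    · rintro rfl
      exact ⟨rfl, by simp only; omega⟩
    · rintro ⟨h1, h2⟩
      exact event_ext h1.symm (by simp only; omega)
  · simp only [false_iff, proc_iff]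
    omega

theorem next_eq_some {e f : M.Event} : M.next e = some f ↔ M.proc e f := by
  unfold next
  split_ifs with h
  · rw [Option.some_inj, proc_iff]
    constructor
    · rintro rfl
      exact ⟨rfl, rfl⟩
    · rintro ⟨h1, h2⟩
      exact event_ext h1 h2
  · simp only [false_iff, proc_iff]
    rintro ⟨h1, h2⟩
    have := f.2.2
    have := congrArg M.len h1
    omega

theorem rcv_eq_some {e f : M.Event} : M.rcv e = some f ↔ M.msg e f := by
  unfold rcv
  split_ifs with h
  · rw [Option.some_inj]
    constructor
    · rintro rfl
      exact h.choose_spec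
    · intro h'
      exact (M.msg_unique _ _ _ _ h.choose_spec h' (Or.inl rfl)).2
  · simp only [false_iff]
    exact fun h' => h ⟨f, h'⟩

theorem snd_eq_some {e f : M.Event} : M.snd e = some f ↔ M.msg f e := by
  unfold snd
  split_ifs with h
  · rw [Option.some_inj]
    constructor
    · rintro rfl
      exact h.choose_spec
    · intro h'
      exact (M.msg_unique _ _ _ _ h.choose_spec h' (Or.inr (Or.inr (Or.inr rfl)))).1
  · simp only [false_iff]
    exact fun h' => h ⟨f, h'⟩

theorem not_msg_of_msg {e f g : M.Event} (h : M.msg e f) : ¬ M.msg f g := by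
  intro h'
  obtain ⟨h1, -⟩ := M.msg_unique _ _ _ _ h h' (Or.inr (Or.inr (Or.inl rfl)))
  exact M.msg_ne _ _ h (congrArg Sigma.fst h1)

theorem prev_eq_none {e : M.Event} : M.prev e = none ↔ (e.2 : ℕ) = 0 := by
  unfold prev
  split_ifs with h <;> simp <;> omega

theorem next_eq_none {e : M.Event} : M.next e = none ↔ (e.2 : ℕ) + 1 = M.len e.1 := by
  have := e.2.2
  unfold next
  split_ifs with h <;> simp <;> omega

theorem rcv_eq_none {e : M.Event} : M.rcv e = none ↔ ∀ f, ¬ M.msg e f := by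
  simp only [Option.eq_none_iff_forall_ne_some, Ne, rcv_eq_some]

theorem snd_eq_none {e : M.Event} : M.snd e = none ↔ ∀ f, ¬ M.msg f e := by
  simp only [Option.eq_none_iff_forall_ne_some, Ne, snd_eq_some]

theorem prev_zero (p : P) (h : 0 < M.len p) : M.prev ⟨p, ⟨0, h⟩⟩ = none := prev_eq_none.2 rfl

theorem prev_succ (p : P) (i : ℕ) (h : i + 1 < M.len p) :
    M.prev ⟨p, ⟨i + 1, h⟩⟩ = some ⟨p, ⟨i, by omega⟩⟩ := prev_eq_some.2 ⟨rfl, rfl⟩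

end MSC

/-! ### Machines from local constraints -/

/-- Local constraints on labellings of events by elements of `D`. The relation `ok p d` relates the
process and the label of an event to the labels of the previous event, the next event, the receive
event of its message and the send event of its message; `fin` restricts the last labels. -/
structure Tiling (P D : Type u) where
  ok : P → D → Option D → Option D → Option (P × D) → Option (P × D) → Prop
  fin : (P → Option D) → Prop

namespace Tiling

variable {P D B : Type u}

/-- The labelling `σ` of the events of `M` satisfies the constraints. -/
structure Sat {A : Type v} (𝒯 : Tiling P D) (M : MSC P A) (σ : M.Event → D) : Prop where
  ok : ∀ e, 𝒯.ok e.1 (σ e) ((M.prev e).map σ) ((M.next e).map σ)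
    ((M.rcv e).map fun f => (f.1, σ f)) ((M.snd e).map fun f => (f.1, σ f))
  fin : 𝒯.fin fun p => (M.lastEvent p).map σ

/-- The label of the previous event, recorded in the source state `s`; the state has to announce
the current label `d`. -/
inductive Source (d : D) : Option (D × Option D) → Option D → Prop
  | init : Source d none none
  | step (d' : D) : Source d (some (d', some d)) (some d')

/-- The labels of the message partners according to an action of an event with label `d`. -/
inductive Partner {p : P} (d : D) :
    ProcAction B (D × D) p → Option (P × D) → Option (P × D) → Prop
  | internal (b : B) : Partner d (.internal b) none none
  | send (b : B) (d' : D) (q : {q : P // q ≠ p}) :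
      Partner d (.send b (d, d') q) (some (q.1, d')) none
  | receive (b : B) (d' : D) (q : {q : P // q ≠ p}) :
      Partner d (.receive b (d', d) q) none (some (q.1, d'))

/-- The machine that guesses a labelling and checks the constraints; `ℓ d` is the letter at an
event with label `d`. -/
def toCFM (𝒯 : Tiling P D) [Finite D] (ℓ : D → B) : CFM P B where
  -- Labels of the send and of the receive event: the sender guesses the second, the receiver
  -- confirms it, so each end knows the other.
  Message := D × D
  finite_message := inferInstance
  -- `none` is the state before the first event; the second component announces the label of the
  -- next event.
  State _ := Option (D × Option D)
  finite_state _ := inferInstance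
  init _ := none
  trans p := {t | ∃ d prev next rcv snd, 𝒯.ok p d prev next rcv snd ∧
    Source d t.source prev ∧ t.target = some (d, next) ∧ t.action.letter = ℓ d ∧
    Partner d t.action rcv snd}
  -- A last state must not announce a further event.
  acc := {s | (∀ p d, ∀ next ∈ (s p).map Prod.snd, next ≠ some d) ∧
    𝒯.fin fun p => (s p).map Prod.fst}

variable {ℓ : D → B}

/-- The action at an event of an MSC labelled by `σ`. -/
noncomputable def actionAt (ℓ : D → B) (M : MSC P B) (σ : M.Event → D) (e : M.Event) :
    ProcAction B (D × D) e.1 :=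
  open Classical in
  if h : ∃ f, M.msg e f then
    .send (ℓ (σ e)) (σ e, σ h.choose) ⟨h.choose.1, (M.msg_ne e _ h.choose_spec).symm⟩
  else if h : ∃ f, M.msg f e then
    .receive (ℓ (σ e)) (σ h.choose, σ e) ⟨h.choose.1, M.msg_ne _ e h.choose_spec⟩
  else .internal (ℓ (σ e))

theorem actionAt_letter (M : MSC P B) (σ : M.Event → D) (e : M.Event) :
    (actionAt ℓ M σ e).letter = ℓ (σ e) := by
  unfold actionAt
  split_ifs <;> rfl

theorem actionAt_send {M : MSC P B} (σ : M.Event → D) {e f : M.Event} (h : M.msg e f) :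
    actionAt ℓ M σ e = .send (ℓ (σ e)) (σ e, σ f) ⟨f.1, (M.msg_ne e f h).symm⟩ := by
  have h' : ∃ f, M.msg e f := ⟨f, h⟩
  have hf : h'.choose = f := (M.msg_unique _ _ _ _ h'.choose_spec h (Or.inl rfl)).2
  unfold actionAt
  rw [dif_pos h']
  congr

theorem actionAt_receive {M : MSC P B} (σ : M.Event → D) {e f : M.Event} (h : M.msg e f) :
    actionAt ℓ M σ f = .receive (ℓ (σ f)) (σ e, σ f) ⟨e.1, M.msg_ne e f h⟩ := by
  have h' : ∃ e, M.msg e f := ⟨e, h⟩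
  have hf : h'.choose = e :=
    (M.msg_unique _ _ _ _ h'.choose_spec h (Or.inr (Or.inr (Or.inr rfl)))).1
  unfold actionAt
  rw [dif_neg (fun ⟨g, hg⟩ => MSC.not_msg_of_msg h hg), dif_pos h']
  congr

theorem actionAt_internal {M : MSC P B} (σ : M.Event → D) {e : M.Event} (h : M.IsInternal e) :
    actionAt ℓ M σ e = .internal (ℓ (σ e)) := by
  unfold actionAt
  rw [dif_neg (fun ⟨f, hf⟩ => (h f).1 hf), dif_neg (fun ⟨f, hf⟩ => (h f).2 hf)]

theorem partner_actionAt (M : MSC P B) (σ : M.Event → D) (e : M.Event) :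
    Partner (σ e) (actionAt ℓ M σ e) ((M.rcv e).map fun f => (f.1, σ f))
      ((M.snd e).map fun f => (f.1, σ f)) := by
  by_cases h : ∃ f, M.msg e f
  · obtain ⟨f, h⟩ := h
    rw [actionAt_send σ h, MSC.rcv_eq_some.2 h,
      MSC.snd_eq_none.2 fun g hg => MSC.not_msg_of_msg hg h]
    exact Partner.send _ _ _
  by_cases h' : ∃ f, M.msg f e
  · obtain ⟨f, h'⟩ := h'
    rw [actionAt_receive σ h', MSC.snd_eq_some.2 h',
      MSC.rcv_eq_none.2 fun g hg => MSC.not_msg_of_msg h' hg]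
    exact Partner.receive _ _ _
  push Not at h h'
  rw [actionAt_internal σ fun f => ⟨h f, h' f⟩, MSC.snd_eq_none.2 h', MSC.rcv_eq_none.2 h]
  exact Partner.internal _

theorem mem_language_of_sat [Finite D] {𝒯 : Tiling P D} {M : MSC P B} {σ : M.Event → D} (h : 𝒯.Sat M σ)
    (hℓ : ∀ e, ℓ (σ e) = M.letterAt e) : M ∈ (𝒯.toCFM ℓ).language := by
  refine ⟨fun e => ⟨(M.prev e).map fun x => (σ x, some (σ e)), actionAt ℓ M σ e,
    some (σ e, (M.next e).map σ)⟩, ⟨?_, ?_, ?_, ?_, ?_, ?_⟩, ?_⟩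
  · intro e
    refine ⟨σ e, _, _, _, _, h.ok e, ?_, rfl, actionAt_letter M σ e, partner_actionAt M σ e⟩
    cases M.prev e with
    | none => exact Source.init
    | some x => exact Source.step _
  · intro e
    exact (actionAt_letter M σ e).trans (hℓ e)
  · intro p hp
    simp only [MSC.prev_zero]
    rfl
  · intro p i j hij
    simp only [MSC.next_eq_some.2 hij, MSC.prev_eq_some.2 hij]
    rfl
  · intro e he
    exact ⟨_, actionAt_internal σ he⟩
  · intro e f hef
    exact ⟨_, _, _, actionAt_send σ hef, actionAt_receive σ hef⟩
  · constructor
    · intro p d next hnext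
      unfold CFM.finalState at hnext
      split_ifs at hnext with hp
      · have : M.next ⟨p, ⟨M.len p - 1, Nat.sub_lt hp Nat.one_pos⟩⟩ = none :=
          MSC.next_eq_none.2 (by simp only; omega)
        simp only [this] at hnext
        simp only [Option.map_none, Option.map_some, Option.mem_def, Option.some.injEq] at hnext
        rw [← hnext]
        exact Option.some_ne_none d |>.symm
      · simp [toCFM] at hnext
    · convert h.fin using 1
      funext p
      unfold CFM.finalState MSC.lastEvent
      split_ifs <;> rfl

/-- Announcements are fulfilled by the source condition at the next event and excluded at the last
event by acceptance; the pair of labels in a message makes both partners agree. -/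
theorem exists_sat_of_mem_language [Finite D] {𝒯 : Tiling P D} {M : MSC P B}
    (h : M ∈ (𝒯.toCFM ℓ).language) :
    ∃ σ : M.Event → D, 𝒯.Sat M σ ∧ ∀ e, ℓ (σ e) = M.letterAt e := by
  obtain ⟨ρ, hρ, hacc⟩ := h
  choose σ prev next rcv snd hok hsource htarget hletter hpartner using hρ.mem
  have hprev : ∀ e, prev e = (M.prev e).map σ ∧
      ∀ x ∈ M.prev e, next x = some (σ e) := by
    rintro ⟨p, ⟨i, hi⟩⟩
    cases i with
    | zero =>
      have h1 := hsource ⟨p, ⟨0, hi⟩⟩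
      rw [hρ.source_first p hi] at h1
      rw [MSC.prev_zero]
      refine ⟨?_, by simp⟩
      generalize prev ⟨p, ⟨0, hi⟩⟩ = y at h1
      cases h1
      rfl
    | succ i =>
      have h1 := hsource ⟨p, ⟨i + 1, hi⟩⟩
      rw [← hρ.target_eq_source p ⟨i, by omega⟩ ⟨i + 1, hi⟩ ⟨rfl, rfl⟩, htarget] at h1
      rw [MSC.prev_succ]
      generalize prev ⟨p, ⟨i + 1, hi⟩⟩ = y at h1
      generalize hz : next ⟨p, ⟨i, by omega⟩⟩ = z at h1
      cases h1
      refine ⟨rfl, ?_⟩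
      rintro x ⟨⟩
      exact hz
  have hnext : ∀ e, next e = (M.next e).map σ := by
    intro e
    cases hx : M.next e with
    | some x =>
      exact (hprev x).2 e (MSC.prev_eq_some.2 (MSC.next_eq_some.1 hx))
    | none =>
      rw [MSC.next_eq_none] at hx
      have hp : 0 < M.len e.1 := by omega
      have he : (⟨e.1, ⟨M.len e.1 - 1, Nat.sub_lt hp Nat.one_pos⟩⟩ : M.Event) = e :=
        MSC.event_ext rfl (by simp only; omega)
      have := hacc.1 e.1
      unfold CFM.finalState at this
      rw [dif_pos hp, htarget, he] at this
      refine Option.eq_none_iff_forall_ne_some.2 fun d => this d _ rfl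
  have hrs : ∀ e, rcv e = (M.rcv e).map (fun f => (f.1, σ f)) ∧
      snd e = (M.snd e).map (fun f => (f.1, σ f)) := by
    have key : ∀ e f, M.msg e f → rcv e = some (f.1, σ f) ∧ snd e = none ∧
        snd f = some (e.1, σ e) ∧ rcv f = none := by
      intro e f hef
      obtain ⟨m, a, b, h1, h2⟩ := hρ.message e f hef
      have p1 := hpartner e
      have p2 := hpartner f
      rw [h1] at p1
      rw [h2] at p2
      generalize rcv e = x1 at p1
      generalize snd e = x2 at p1
      generalize rcv f = x3 at p2
      generalize snd f = x4 at p2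
      generalize σ e = s1 at *
      generalize σ f = s2 at *
      cases p1
      cases p2
      exact ⟨rfl, rfl, rfl, rfl⟩
    intro e
    by_cases h : ∃ f, M.msg e f
    · obtain ⟨f, h⟩ := h
      rw [MSC.rcv_eq_some.2 h, MSC.snd_eq_none.2 fun g hg => MSC.not_msg_of_msg hg h]
      exact ⟨(key e f h).1, (key e f h).2.1⟩
    by_cases h' : ∃ f, M.msg f e
    · obtain ⟨f, h'⟩ := h'
      rw [MSC.snd_eq_some.2 h', MSC.rcv_eq_none.2 fun g hg => MSC.not_msg_of_msg h' hg]
      exact ⟨(key f e h').2.2.2, (key f e h').2.2.1⟩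
    push Not at h h'
    rw [MSC.snd_eq_none.2 h', MSC.rcv_eq_none.2 h]
    obtain ⟨a, ha⟩ := hρ.internal e fun f => ⟨h f, h' f⟩
    have p1 := hpartner e
    rw [ha] at p1
    generalize rcv e = x1 at p1
    generalize snd e = x2 at p1
    cases p1
    exact ⟨rfl, rfl⟩
  refine ⟨σ, ⟨fun e => ?_, ?_⟩, fun e => (hletter e).symm.trans (hρ.letter_eq e)⟩
  · rw [← (hprev e).1, ← hnext e, ← (hrs e).1, ← (hrs e).2]
    exact hok e
  · convert hacc.2 using 1
    funext p
    unfold CFM.finalState MSC.lastEvent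
    split_ifs with hp
    · rw [htarget]
      rfl
    · rfl

end Tiling

/-! ### The causal order -/

namespace MSC

variable {P : Type u} {A : Type v} {M : MSC P A}

theorem procEdges_iff {len : P → ℕ} {e f : EventOf len} :
    Relation.ReflTransGen (ProcEdge len) e f ↔ e.1 = f.1 ∧ (e.2 : ℕ) ≤ f.2 := by
  constructor
  · intro h
    induction h with
    | refl => exact ⟨rfl, le_rfl⟩
    | tail _ h ih => exact ⟨ih.1.trans h.1, ih.2.trans (by have := h.2; omega)⟩
  · obtain ⟨p, i, hi⟩ := e
    obtain ⟨q, j, hj⟩ := f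
    rintro ⟨h, h'⟩
    obtain rfl : p = q := h
    change i ≤ j at h'
    induction j, h' using Nat.le_induction with
    | base => exact Relation.ReflTransGen.refl
    | succ j _ ih => exact (ih (by omega)).tail ⟨rfl, rfl⟩

theorem le_of_proc_le {e f : M.Event} (h : e.1 = f.1) (h' : (e.2 : ℕ) ≤ f.2) : M.le e f :=
  Relation.ReflTransGen.mono (fun _ _ => Or.inl) _ _ (procEdges_iff.2 ⟨h, h'⟩)

theorem le_trans {e f g : M.Event} (h : M.le e f) (h' : M.le f g) : M.le e g :=
  Relation.ReflTransGen.trans h h'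

theorem lt_of_le_of_lt {e f g : M.Event} (h : M.le e f) (h' : M.lt f g) : M.lt e g :=
  Relation.TransGen.trans_right h h'

theorem lt_of_lt_of_le {e f g : M.Event} (h : M.lt e f) (h' : M.le f g) : M.lt e g :=
  Relation.TransGen.trans_left h h'

theorem lt_irrefl (e : M.Event) : ¬ M.lt e e := M.acyclic e

theorem lt_of_msg {e f : M.Event} (h : M.msg e f) : M.lt e f := Relation.TransGen.single (Or.inr h)

theorem lt_of_proc {e f : M.Event} (h : M.proc e f) : M.lt e f :=
  Relation.TransGen.single (Or.inl h)

theorem le_of_lt {e f : M.Event} (h : M.lt e f) : M.le e f := Relation.TransGen.to_reflTransGen h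

theorem lt_of_le_of_ne {e f : M.Event} (h : M.le e f) (h' : e ≠ f) : M.lt e f := by
  rcases Relation.reflTransGen_iff_eq_or_transGen.1 h with h | h
  · exact absurd h.symm h'
  · exact h

theorem lt_of_pos_lt {e f : M.Event} (h : e.1 = f.1) (h' : (e.2 : ℕ) < f.2) : M.lt e f :=
  lt_of_le_of_ne (le_of_proc_le h h'.le) (by rintro rfl; exact h'.ne rfl)

theorem le_iff_of_eq {e f : M.Event} (h : e.1 = f.1) : M.le e f ↔ (e.2 : ℕ) ≤ f.2 := by
  refine ⟨fun h' => ?_, le_of_proc_le h⟩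
  by_contra! hlt
  exact lt_irrefl _ (lt_of_le_of_lt h' (lt_of_pos_lt h.symm hlt))

theorem lt_iff_of_eq {e f : M.Event} (h : e.1 = f.1) : M.lt e f ↔ (e.2 : ℕ) < f.2 := by
  refine ⟨fun h' => ?_, lt_of_pos_lt h⟩
  by_contra! hlt
  exact lt_irrefl _ (lt_of_le_of_lt (le_of_proc_le h.symm hlt) h')

theorem lt_wellFounded [Finite P] (M : MSC P A) : WellFounded M.lt := by
  have : IsTrans M.Event M.lt := ⟨fun _ _ _ => Relation.TransGen.trans⟩
  have : Std.Irrefl M.lt := ⟨lt_irrefl⟩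
  exact Finite.wellFounded_of_trans_of_irrefl _

theorem gt_wellFounded [Finite P] (M : MSC P A) : WellFounded fun e f => M.lt f e := by
  have : IsTrans M.Event fun e f => M.lt f e := ⟨fun _ _ _ h h' => Relation.TransGen.trans h' h⟩
  have : Std.Irrefl fun e f => M.lt f e := ⟨lt_irrefl⟩
  exact Finite.wellFounded_of_trans_of_irrefl _

theorem fifo_le {e f e' f' : M.Event} (h : M.msg e f) (h' : M.msg e' f') (he : e.1 = e'.1)
    (hf : f.1 = f'.1) : (e.2 : ℕ) ≤ e'.2 ↔ (f.2 : ℕ) ≤ f'.2 := by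
  have := M.fifo e f e' f' h h' he hf
  rw [procEdges_iff, procEdges_iff] at this
  simpa [he, hf] using this

/-! ### Cuts and paths of processes -/

open Classical in
/-- A cut of process `p` is the number of events before it. A cut of `p` is sent to the cut of `q`
right after the send event of the last message from `q` that is received in `p` before the cut. -/
noncomputable def hop (M : MSC P A) (p q : P) : ℕ → ℕ
  | 0 => 0
  | i + 1 => if h : ∃ j : Fin (M.len q), ∃ hi : i < M.len p, M.msg ⟨q, j⟩ ⟨p, ⟨i, hi⟩⟩
      then h.choose + 1 else hop M p q i

/-- Iterated hops, from process `p` along the list `u` of processes. -/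
noncomputable def lcut (M : MSC P A) : P → List P → ℕ → ℕ
  | _, [], i => i
  | p, q :: u, i => M.lcut q u (M.hop p q i)

/-- The last process of the path that starts in `p` and continues with `u`. -/
def pend : P → List P → P
  | p, [] => p
  | _, q :: u => pend q u

theorem hop_succ_of_msg {e f : M.Event} (h : M.msg e f) :
    M.hop f.1 e.1 (f.2 + 1) = e.2 + 1 := by
  have h' : ∃ j : Fin (M.len e.1), ∃ hi : (f.2 : ℕ) < M.len f.1,
      M.msg ⟨e.1, j⟩ ⟨f.1, ⟨f.2, hi⟩⟩ := ⟨e.2, f.2.2, h⟩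
  obtain ⟨_, h1⟩ := h'.choose_spec
  have h2 := (M.msg_unique _ _ _ _ h1 h (Or.inr (Or.inr (Or.inr rfl)))).1
  have h3 : h'.choose = e.2 := eq_of_heq (Sigma.mk.inj_iff.1 h2).2
  rw [hop, dif_pos h', h3]

theorem hop_succ_of_not_msg {f : M.Event} {q : P} (h : ∀ e, M.msg e f → e.1 ≠ q) :
    M.hop f.1 q (f.2 + 1) = M.hop f.1 q f.2 := by
  rw [hop, dif_neg]
  rintro ⟨j, hj, h'⟩
  exact h _ h' rfl

theorem exists_of_hop_pos {p q : P} {m : ℕ} (h : 0 < M.hop p q m) :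
    ∃ e f : M.Event, M.msg e f ∧ e.1 = q ∧ f.1 = p ∧ (f.2 : ℕ) < m ∧ M.hop p q m = e.2 + 1 := by
  induction m with
  | zero => exact absurd h (Nat.lt_irrefl 0)
  | succ i ih =>
    by_cases h' : ∃ j : Fin (M.len q), ∃ hi : i < M.len p, M.msg ⟨q, j⟩ ⟨p, ⟨i, hi⟩⟩
    · obtain ⟨j, hi, h'⟩ := h'
      exact ⟨_, _, h', rfl, rfl, Nat.lt_succ_self i, hop_succ_of_msg h'⟩
    · rw [hop, dif_neg h'] at h ⊢
      obtain ⟨e, f, h1, h2, h3, h4, h5⟩ := ih h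
      exact ⟨e, f, h1, h2, h3, h4.trans (Nat.lt_succ_self i), h5⟩

theorem hop_le_len (p q : P) (m : ℕ) : M.hop p q m ≤ M.len q := by
  rcases Nat.eq_zero_or_pos (M.hop p q m) with h | h
  · omega
  · obtain ⟨e, f, _, rfl, _, _, h⟩ := exists_of_hop_pos h
    have := e.2.2
    omega

/-- By FIFO a later receive from `q` belongs to a later send, so advancing the cut never moves its
image back. -/
theorem hop_monotone (p q : P) : Monotone (M.hop p q) := by
  refine monotone_nat_of_le_succ fun i => ?_
  by_cases h' : ∃ j : Fin (M.len q), ∃ hi : i < M.len p, M.msg ⟨q, j⟩ ⟨p, ⟨i, hi⟩⟩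
  · obtain ⟨j, hi, h'⟩ := h'
    rw [hop_succ_of_msg h']
    rcases Nat.eq_zero_or_pos (M.hop p q i) with h | h
    · omega
    · obtain ⟨e, f, h1, h2, h3, h4, h5⟩ := exists_of_hop_pos h
      have : (e.2 : ℕ) ≤ j := (fifo_le h1 h' h2 h3).2 h4.le
      simp only at this ⊢
      omega
  · rw [hop, dif_neg h']

theorem lcut_zero (p : P) (u : List P) : M.lcut p u 0 = 0 := by
  induction u generalizing p with
  | nil => rfl
  | cons q u ih => exact ih q

theorem lcut_monotone (p : P) (u : List P) : Monotone (M.lcut p u) := by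
  induction u generalizing p with
  | nil => exact monotone_id
  | cons q u ih => exact (ih q).comp (hop_monotone p q)

theorem lcut_le_len (p : P) (u : List P) {m : ℕ} (h : m ≤ M.len p) :
    M.lcut p u m ≤ M.len (pend p u) := by
  induction u generalizing p m with
  | nil => exact h
  | cons q u ih => exact ih q (hop_le_len p q m)

theorem lcut_cons_of_msg {e f : M.Event} (h : M.msg e f) (u : List P) :
    M.lcut f.1 (e.1 :: u) (f.2 + 1) = M.lcut e.1 u (e.2 + 1) := by
  rw [lcut, hop_succ_of_msg h]

theorem lcut_cons_of_not_msg {f : M.Event} {q : P} (h : ∀ e, M.msg e f → e.1 ≠ q) (u : List P) :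
    M.lcut f.1 (q :: u) (f.2 + 1) = M.lcut f.1 (q :: u) f.2 := by
  rw [lcut, hop_succ_of_not_msg h, lcut]

/-- Soundness of paths: every hop goes back over a message whose receive event lies before the cut.
-/
theorem exists_le_of_lt_lcut {p : P} {u : List P} {m : ℕ} {f : M.Event} (hf : f.1 = pend p u)
    (h : (f.2 : ℕ) < M.lcut p u m) : ∃ e : M.Event, e.1 = p ∧ (e.2 : ℕ) < m ∧ M.le f e := by
  induction u generalizing p m with
  | nil => exact ⟨f, hf, h, Relation.ReflTransGen.refl⟩
  | cons q u ih =>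
    obtain ⟨e, he, hlt, hle⟩ := ih hf h
    obtain ⟨x, y, hxy, rfl, rfl, hy, hx⟩ := exists_of_hop_pos (Nat.zero_lt_of_lt hlt)
    exact ⟨y, rfl, hy, le_trans hle (le_trans (le_of_proc_le he (by omega))
      (le_of_lt (lt_of_msg hxy)))⟩

theorem le_of_lt_lcut {e f : M.Event} {u : List P} (hf : pend e.1 u = f.1)
    (h : (f.2 : ℕ) < M.lcut e.1 u (e.2 + 1)) : M.le f e := by
  obtain ⟨x, hx, hlt, hle⟩ := exists_le_of_lt_lcut hf.symm h
  exact le_trans hle (le_of_proc_le hx (by omega))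

/-- Each cut met along the way lies right after a send event below `x`. Restarting from the one on
`p` yields the shortcut that removes loops from paths. -/
theorem exists_suffix_of_mem {f x : M.Event} {u : List P} {p : P} (hp : p ∈ u)
    (h : (f.2 : ℕ) < M.lcut x.1 u (x.2 + 1)) :
    ∃ u' : List P, ∃ y : M.Event, (p :: u') <:+ u ∧ y.1 = p ∧ M.le y x ∧
      pend p u' = pend x.1 u ∧ (f.2 : ℕ) < M.lcut p u' (y.2 + 1) := by
  induction u generalizing x with
  | nil => simp at hp
  | cons q u ih =>
    rw [lcut] at h
    have hpos : 0 < M.hop x.1 q (x.2 + 1) := by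
      by_contra! h0
      rw [Nat.le_zero.1 h0, lcut_zero] at h
      omega
    obtain ⟨z, y, hzy, rfl, hy, hlt, heq⟩ := exists_of_hop_pos hpos
    have hzx : M.le z x :=
      le_trans (le_of_lt (lt_of_msg hzy)) (le_of_proc_le hy (by omega))
    rw [heq] at h
    by_cases hpq : p = z.1
    · subst hpq
      exact ⟨u, z, List.suffix_refl _, rfl, hzx, rfl, h⟩
    · obtain ⟨u', y, h1, h2, h3, h4, h5⟩ :=
        ih ((List.mem_cons.1 hp).resolve_left hpq) h
      exact ⟨u', y, h1.trans (List.suffix_cons _ _), h2, le_trans h3 hzx, h4, h5⟩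

/-- Induction along the chain from `f` to `e`. A message edge prepends the process of its send
event. If the process of `e` already occurs, the path is shortened to start at that occurrence; the
event found there precedes `e`, so the cut from `e` is at least as large. -/
theorem exists_nodup_of_le {e f : M.Event} (h : M.le f e) :
    ∃ u : List P, (e.1 :: u).Nodup ∧ pend e.1 u = f.1 ∧ (f.2 : ℕ) < M.lcut e.1 u (e.2 + 1) := by
  induction h with
  | refl => exact ⟨[], by simp, rfl, Nat.lt_succ_self _⟩
  | @tail x e hfx hxe ih =>
    obtain ⟨u, h1, h2, h3⟩ := ih
    rcases hxe with hxe | hxe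
    · obtain ⟨p, i, hi⟩ := x
      obtain ⟨q, j, hj⟩ := e
      obtain ⟨h4, h5⟩ := hxe
      obtain rfl : p = q := h4
      exact ⟨u, h1, h2, h3.trans_le (lcut_monotone _ _ (by simp only at h5 ⊢; omega))⟩
    · by_cases hmem : e.1 ∈ u
      · obtain ⟨u', y, h4, h5, h6, h7, h8⟩ := exists_suffix_of_mem hmem h3
        refine ⟨u', (h1.of_cons).sublist h4.sublist, h7.trans h2, h8.trans_le ?_⟩
        have := (lt_iff_of_eq h5).1 (lt_of_le_of_lt h6 (lt_of_msg hxe))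
        exact lcut_monotone _ _ (by omega)
      · refine ⟨x.1 :: u, ?_, h2, by rwa [lcut_cons_of_msg hxe]⟩
        rw [List.nodup_cons]
        refine ⟨?_, h1⟩
        rw [List.mem_cons, not_or]
        exact ⟨(M.msg_ne _ _ hxe).symm, hmem⟩

variable (P) in
/-- Lists of processes, at most as long as there are processes. -/
abbrev Path : Type u := {u : List P // u.length ≤ Nat.card P}

theorem le_iff_exists_path [Finite P] {e f : M.Event} :
    M.le f e ↔ ∃ u : Path P, pend e.1 u.1 = f.1 ∧ (f.2 : ℕ) < M.lcut e.1 u.1 (e.2 + 1) := by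
  constructor
  · intro h
    obtain ⟨u, h1, h2⟩ := exists_nodup_of_le h
    have := Fintype.ofFinite P
    refine ⟨⟨u, ?_⟩, h2⟩
    rw [Nat.card_eq_fintype_card]
    exact h1.of_cons.length_le_card
  · rintro ⟨u, h1, h2⟩
    exact le_of_lt_lcut h1 h2

theorem exists_path [Finite P] (p q : P) : ∃ u : Path P, pend p u.1 = q := by
  refine ⟨⟨[q], ?_⟩, rfl⟩
  have : Nonempty P := ⟨p⟩
  exact Nat.card_pos

/-! ### Searching on a process -/

open Classical in
/-- The first event in `S` on process `q` from position `k` on. -/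
noncomputable def nxt (M : MSC P A) (S : M.Event → Prop) (q : P) (k : ℕ) : Option M.Event :=
  if h : k < M.len q then
    if S ⟨q, ⟨k, h⟩⟩ then some ⟨q, ⟨k, h⟩⟩ else M.nxt S q (k + 1)
  else none
termination_by M.len q - k

open Classical in
/-- The last event in `S` on process `q` before position `k`. -/
noncomputable def prv (M : MSC P A) (S : M.Event → Prop) (q : P) : ℕ → Option M.Event
  | 0 => none
  | k + 1 => if h : ∃ hk : k < M.len q, S ⟨q, ⟨k, hk⟩⟩ then some ⟨q, ⟨k, h.1⟩⟩ else M.prv S q k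

variable {S : M.Event → Prop}

theorem nxt_spec {q : P} {k : ℕ} {g : M.Event} (h : M.nxt S q k = some g) :
    g.1 = q ∧ k ≤ g.2 ∧ S g := by
  induction hm : M.len q - k generalizing k with
  | zero =>
    rw [nxt, dif_neg (by omega)] at h
    cases h
  | succ m ih =>
    rw [nxt, dif_pos (by omega)] at h
    split_ifs at h with hS
    · cases h
      exact ⟨rfl, le_rfl, hS⟩
    · obtain ⟨h1, h2, h3⟩ := ih h (by omega)
      exact ⟨h1, by omega, h3⟩

theorem exists_nxt {k : ℕ} {f : M.Event} (hS : S f) (hk : k ≤ f.2) :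
    ∃ g, M.nxt S f.1 k = some g ∧ (g.2 : ℕ) ≤ f.2 := by
  have hf := f.2.2
  induction hm : (f.2 : ℕ) - k generalizing k with
  | zero =>
    obtain rfl : k = f.2 := by omega
    exact ⟨f, by rw [nxt, dif_pos f.2.2]; exact if_pos hS, le_rfl⟩
  | succ m ih =>
    rw [nxt, dif_pos (by omega)]
    split_ifs with h
    · exact ⟨_, rfl, hk⟩
    · exact ih (by omega) (by omega)

theorem nxt_mono {q : P} {k k' : ℕ} {g g' : M.Event} (hk : k ≤ k') (h : M.nxt S q k = some g)
    (h' : M.nxt S q k' = some g') : (g.2 : ℕ) ≤ g'.2 := by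
  obtain ⟨rfl, h2, h3⟩ := nxt_spec h'
  obtain ⟨x, hx, hle⟩ := exists_nxt h3 (hk.trans h2)
  rw [h] at hx
  cases hx
  exact hle

theorem nxt_eq_none {q : P} {k : ℕ} (h : M.len q ≤ k) : M.nxt S q k = none := by
  rw [nxt, dif_neg (by omega)]

theorem prv_spec {q : P} {k : ℕ} {g : M.Event} (h : M.prv S q k = some g) :
    g.1 = q ∧ (g.2 : ℕ) < k ∧ S g := by
  induction k with
  | zero => cases h
  | succ k ih =>
    rw [prv] at h
    split_ifs at h with hS
    · cases h
      exact ⟨rfl, Nat.lt_succ_self k, hS.2⟩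
    · obtain ⟨h1, h2, h3⟩ := ih h
      exact ⟨h1, by omega, h3⟩

theorem exists_prv {k : ℕ} {f : M.Event} (hS : S f) (hk : (f.2 : ℕ) < k) :
    ∃ g, M.prv S f.1 k = some g ∧ (f.2 : ℕ) ≤ g.2 := by
  induction k with
  | zero => omega
  | succ k ih =>
    rw [prv]
    split_ifs with h
    · exact ⟨_, rfl, by simp only; omega⟩
    · refine ih (Nat.lt_of_le_of_ne (by omega) fun h' => h ?_)
      subst h'
      exact ⟨f.2.2, hS⟩

theorem prv_mono {q : P} {k k' : ℕ} {g g' : M.Event} (hk : k ≤ k') (h : M.prv S q k = some g)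
    (h' : M.prv S q k' = some g') : (g.2 : ℕ) ≤ g'.2 := by
  obtain ⟨rfl, h2, h3⟩ := prv_spec h
  obtain ⟨x, hx, hle⟩ := exists_prv h3 (h2.trans_le hk)
  rw [h'] at hx
  cases hx
  exact hle

end MSC

/-! ### Values at cuts and their propagation -/

namespace MSC

variable {P : Type u} {A : Type v} {M : MSC P A} {V : Type*}

/-- The value at a cut: the value of `g` at the last event before the cut, `β q` if there is
none. -/
def cutVal (M : MSC P A) (g : M.Event → V) (β : P → V) (q : P) : ℕ → V
  | 0 => β q
  | k + 1 => if h : k < M.len q then g ⟨q, ⟨k, h⟩⟩ else β q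

theorem cutVal_succ (g : M.Event → V) (β : P → V) (e : M.Event) :
    M.cutVal g β e.1 (e.2 + 1) = g e := dif_pos e.2.2

theorem cutVal_self (g : M.Event → V) (β : P → V) (e : M.Event) :
    M.cutVal g β e.1 e.2 = (M.prev e).elim (β e.1) g := by
  obtain ⟨p, i, hi⟩ := e
  cases i with
  | zero => rw [prev_zero]; rfl
  | succ i => rw [prev_succ]; exact dif_pos (Nat.lt_of_succ_lt hi)

/-- The local constraint on values `F` pulled along paths: `prev` and `snd` are the values at the
previous event and at the send event, `g` the value for the empty path, `β` the initial values. -/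
def PullOk (F : Path P → V) (prev : Option (Path P → V)) (snd : Option (P × (Path P → V)))
    (g : V) (β : P → V) : Prop :=
  F ⟨[], Nat.zero_le _⟩ = g ∧ ∀ q u (h : (q :: u).length ≤ Nat.card P),
    (∀ s, snd = some s → s.1 = q → F ⟨q :: u, h⟩ = s.2 ⟨u, Nat.le_of_succ_le h⟩) ∧
    ((∀ s, snd = some s → s.1 ≠ q) →
      F ⟨q :: u, h⟩ = prev.elim (β (pend q u)) fun F' => F' ⟨q :: u, h⟩)

/-- The value of `g` at the end of the path `u` from the cut after `e`. -/
noncomputable def pulled (M : MSC P A) (g : M.Event → V) (β : P → V) (e : M.Event) (u : List P) :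
    V :=
  M.cutVal g β (pend e.1 u) (M.lcut e.1 u (e.2 + 1))

theorem pulled_nil (g : M.Event → V) (β : P → V) (e : M.Event) : M.pulled g β e [] = g e :=
  cutVal_succ g β e

theorem pulled_of_msg (g : M.Event → V) (β : P → V) {e f : M.Event} (h : M.msg e f) (u : List P) :
    M.pulled g β f (e.1 :: u) = M.pulled g β e u := by
  unfold pulled
  rw [lcut_cons_of_msg h]
  rfl

theorem pulled_of_not_msg (g : M.Event → V) (β : P → V) {f : M.Event} {q : P}
    (h : ∀ e, M.msg e f → e.1 ≠ q) (u : List P) :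
    M.pulled g β f (q :: u) =
      (M.prev f).elim (β (pend q u)) fun x => M.pulled g β x (q :: u) := by
  unfold pulled
  rw [lcut_cons_of_not_msg h]
  obtain ⟨p, i, hi⟩ := f
  cases i with
  | zero => rw [prev_zero]; simp only [lcut_zero]; rfl
  | succ i => rw [prev_succ]; rfl

/-- The constraint is a recursion with a unique solution: a receive from the first process of the
path shortens the path, and any other event hands on the value of the previous event. -/
theorem pullOk_iff {F : M.Event → Path P → V} {g : M.Event → V} {β : P → V} :
    (∀ e, PullOk (F e) ((M.prev e).map F) ((M.snd e).map fun f => (f.1, F f)) (g e) β) ↔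
      ∀ e u, F e u = M.pulled g β e u.1 := by
  constructor
  · rintro h e ⟨u, hu⟩
    induction u generalizing e with
    | nil => rw [pulled_nil]; exact (h e).1
    | cons q u ih =>
      obtain ⟨p, i, hi⟩ := e
      induction i with
      | zero =>
        by_cases hz : ∃ z, M.msg z ⟨p, ⟨0, hi⟩⟩ ∧ z.1 = q
        · obtain ⟨z, hz, rfl⟩ := hz
          rw [((h _).2 _ _ hu).1 _ (by rw [snd_eq_some.2 hz]; rfl) rfl]
          exact (ih _ _).trans (pulled_of_msg g β hz u).symm
        · push Not at hz
          rw [((h _).2 _ _ hu).2, pulled_of_not_msg g β hz, prev_zero]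
          · rfl
          · intro s hs
            obtain ⟨z, hz', rfl⟩ := Option.map_eq_some_iff.1 hs
            exact hz z (snd_eq_some.1 hz')
      | succ i ih' =>
        by_cases hz : ∃ z, M.msg z ⟨p, ⟨i + 1, hi⟩⟩ ∧ z.1 = q
        · obtain ⟨z, hz, rfl⟩ := hz
          rw [((h _).2 _ _ hu).1 _ (by rw [snd_eq_some.2 hz]; rfl) rfl]
          exact (ih _ _).trans (pulled_of_msg g β hz u).symm
        · push Not at hz
          rw [((h _).2 _ _ hu).2, pulled_of_not_msg g β hz, prev_succ]
          · exact ih' _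
          · intro s hs
            obtain ⟨z, hz', rfl⟩ := Option.map_eq_some_iff.1 hs
            exact hz z (snd_eq_some.1 hz')
  · intro h e
    refine ⟨(h e _).trans (pulled_nil g β e), fun q u hu => ⟨?_, fun hs => ?_⟩⟩
    · intro s hs hq
      obtain ⟨z, hz, rfl⟩ := Option.map_eq_some_iff.1 hs
      subst hq
      simp only [h]
      exact pulled_of_msg g β (snd_eq_some.1 hz) u
    · rw [h, pulled_of_not_msg g β]
      · cases M.prev e with
        | none => rfl
        | some x => exact (h x ⟨q :: u, hu⟩).symm
      · intro z hz
        exact hs (z.1, F z) (by rw [snd_eq_some.2 hz]; rfl)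

/-! ### Searches as local recursions -/

theorem nxt_self_of_mem {S : M.Event → Prop} {e : M.Event} (h : S e) :
    M.nxt S e.1 e.2 = some e := by
  rw [nxt, dif_pos e.2.2]
  exact if_pos h

theorem nxt_succ (S : M.Event → Prop) (e : M.Event) :
    M.nxt S e.1 (e.2 + 1) = (M.next e).bind fun x => M.nxt S x.1 x.2 := by
  cases h : M.next e with
  | none => exact nxt_eq_none (next_eq_none.1 h).ge
  | some x =>
    have h' := proc_iff.1 (next_eq_some.1 h)
    exact congrArg₂ (M.nxt S) h'.1 h'.2

theorem nxt_self_of_not_mem {S : M.Event → Prop} {e : M.Event} (h : ¬ S e) :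
    M.nxt S e.1 e.2 = (M.next e).bind fun x => M.nxt S x.1 x.2 := by
  rw [← nxt_succ, nxt, dif_pos e.2.2]
  exact if_neg h

/-- The recursion runs down from the last event of the process, so the result of a forward search is
guessed and confirmed later. -/
theorem nxt_map_iff {X : M.Event → Option V} {g : M.Event → V} {S : M.Event → Prop} :
    (∀ e, (S e → X e = some (g e)) ∧ (¬ S e → X e = (M.next e).bind X)) ↔
      ∀ e, X e = (M.nxt S e.1 e.2).map g := by
  constructor
  · intro h e
    induction hm : M.len e.1 - e.2 generalizing e with
    | zero => have := e.2.2; omega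
    | succ m ih =>
      by_cases hS : S e
      · rw [(h e).1 hS, nxt_self_of_mem hS]; rfl
      · rw [(h e).2 hS, nxt_self_of_not_mem hS]
        cases hx : M.next e with
        | none => rfl
        | some x =>
          have h' := proc_iff.1 (next_eq_some.1 hx)
          have := congrArg M.len h'.1
          exact ih x (by omega)
  · refine fun h e => ⟨fun hS => by rw [h, nxt_self_of_mem hS]; rfl, fun hS => ?_⟩
    rw [h, nxt_self_of_not_mem hS]
    cases M.next e with
    | none => rfl
    | some x => exact (h x).symm

open Classical in
theorem prv_succ (S : M.Event → Prop) (e : M.Event) :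
    M.prv S e.1 (e.2 + 1) = if S e then some e else M.prv S e.1 e.2 := by
  rw [prv]
  by_cases h : S e
  · rw [if_pos h, dif_pos ⟨e.2.2, h⟩]
  · rw [if_neg h, dif_neg]
    rintro ⟨_, h'⟩
    exact h h'

open Classical in
theorem prv_self (S : M.Event → Prop) (e : M.Event) :
    M.prv S e.1 e.2 =
      (M.prev e).bind fun x => if S x then some x else M.prv S x.1 x.2 := by
  cases h : M.prev e with
  | none => rw [prev_eq_none.1 h]; rfl
  | some x =>
    have h' := proc_iff.1 (prev_eq_some.1 h)
    exact (congrArg₂ (M.prv S) h'.1 h'.2).symm.trans (prv_succ S x)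

open Classical in
theorem prv_map_iff {X : M.Event → Option V} {g : M.Event → V} {S : M.Event → Prop} :
    (∀ e, X e = (M.prev e).bind fun x => if S x then some (g x) else X x) ↔
      ∀ e, X e = (M.prv S e.1 e.2).map g := by
  constructor
  · intro h e
    induction hm : (e.2 : ℕ) using Nat.strong_induction_on generalizing e with
    | _ m ih =>
      subst hm
      rw [prv_self, h]
      cases hx : M.prev e with
      | none => rfl
      | some x =>
        have h' := proc_iff.1 (prev_eq_some.1 hx)
        have := ih x.2 (by omega) x rfl
        simp only [Option.bind_some, this]
        split_ifs <;> rfl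
  · intro h e
    rw [h, prv_self]
    cases M.prev e with
    | none => rfl
    | some x =>
      simp only [Option.bind_some, h]
      split_ifs <;> rfl

end MSC

/-! ### Comparing events with cuts by colours -/

namespace Colouring

theorem exists_change {c : ℕ → Bool} {a b : ℕ} (hab : a ≤ b) (h : c a ≠ c b) :
    ∃ s, a ≤ s ∧ s < b ∧ c s ≠ c (s + 1) := by
  by_contra! hc
  refine h ?_
  induction b, hab using Nat.le_induction with
  | base => rfl
  | succ b hab ih =>
    by_cases hb : c a = c b
    · exact hb.trans (hc b hab (Nat.lt_succ_self b))
    · exact absurd (ih hb fun s h1 h2 => hc s h1 (by omega)) hb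

theorem ne_of_unique_change {c : ℕ → Bool} {a b s : ℕ} (has : a ≤ s) (hsb : s < b)
    (hs : c s ≠ c (s + 1)) (huniq : ∀ t, a ≤ t → t < b → c t ≠ c (t + 1) → t = s) :
    c a ≠ c b := by
  have h1 : c a = c s := by
    by_contra h
    obtain ⟨t, h1, h2, h3⟩ := exists_change has h
    exact h2.ne (huniq t h1 (by omega) h3)
  have h2 : c (s + 1) = c b := by
    by_contra h
    obtain ⟨t, h1, h2, h3⟩ := exists_change hsb h
    have := huniq t (by omega) h2 h3
    omega
  rwa [h1, ← h2]

variable {n : ℕ} {D : ℕ → Prop} {η : ℕ → ℕ}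

/-- Later events first: if `i < η i`, the colour changes at some `s` with `i < s < η i`. The claim
at `s` is already known to be true, so `η s ≤ s < η i`, against monotonicity. -/
theorem le_of_colour {c : ℕ → Bool} (hη : ∀ i j, D i → D j → i ≤ j → η i ≤ η j)
    (hn : ∀ i, D i → η i ≤ n) (hc : ∀ s < n, c s ≠ c (s + 1) → D s)
    (h : ∀ i, D i → c (i + 1) ≠ c (η i)) (i : ℕ) (hi : D i) : η i ≤ i := by
  induction hm : n - i using Nat.strong_induction_on generalizing i with
  | _ m ih =>
    by_contra! hlt
    obtain ⟨s, h1, h2, h3⟩ := exists_change hlt (h i hi)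
    have hi' := hn i hi
    have hs := hc s (by omega) h3
    have h4 := ih (n - s) (by omega) s hs rfl
    have h5 := hη i s hi hs (by omega)
    omega

/-- Earlier events first: if `η i ≤ i`, a change at some `s` with `η i ≤ s < i` gives `s < η s`,
against `η s ≤ η i ≤ s`. -/
theorem lt_of_colour {c : ℕ → Bool} (hη : ∀ i j, D i → D j → i ≤ j → η i ≤ η j)
    (hn : ∀ i, D i → i < n) (hc : ∀ s < n, c s ≠ c (s + 1) → D s)
    (h : ∀ i, D i → c (η i) ≠ c i) (i : ℕ) (hi : D i) : i < η i := by
  induction i using Nat.strong_induction_on with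
  | _ i ih =>
    by_contra! hlt
    obtain ⟨s, h1, h2, h3⟩ := exists_change hlt (h i hi)
    have hs := hc s (h2.trans (hn i hi)) h3
    have h4 := ih s h2 hs
    have h5 := hη s i hs hi h2.le
    omega

/-- A well-founded relation has a kernel: an independent set that every other point of `D` is
related to. -/
theorem exists_kernel {α : Type*} {r : α → α → Prop} (hr : WellFounded r) (D : α → Prop)
    {R : α → α → Prop} (hR : ∀ i s, R i s → r s i) :
    ∃ S : α → Prop, ∀ i, S i ↔ D i ∧ ∀ s, R i s → ¬ S s := by
  refine ⟨hr.fix fun i rec => D i ∧ ∀ s (h : R i s), ¬ rec s (hR i s h), fun i => ?_⟩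
  rw [hr.fix_eq]

theorem exists_colour (S : ℕ → Prop) :
    ∃ c : ℕ → Bool, c 0 = false ∧ ∀ s, c s ≠ c (s + 1) ↔ S s := by
  classical
  refine ⟨fun k => Nat.rec false (fun s x => xor x (decide (S s))) k, rfl, fun s => ?_⟩
  by_cases h : S s <;> simp [h]

/-- Let `S` be a kernel for the relation from `i` to the points of `[η i, i)`. The kernel property
puts a point of `S` into each `[η i, i]`, and with monotonicity excludes a second one. A colour
changing exactly on `S` thus changes exactly once between the cuts `η i` and `i + 1`. -/
theorem exists_colour_of_le (hη : ∀ i j, D i → D j → i ≤ j → η i ≤ η j)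
    (h : ∀ i, D i → η i ≤ i) :
    ∃ c : ℕ → Bool, c 0 = false ∧ (∀ s, c s ≠ c (s + 1) → D s) ∧
      ∀ i, D i → c (i + 1) ≠ c (η i) := by
  obtain ⟨S, hS⟩ := exists_kernel wellFounded_lt D (R := fun i s => η i ≤ s ∧ s < i)
    fun _ _ h => h.2
  obtain ⟨c, h0, hc⟩ := exists_colour S
  refine ⟨c, h0, fun s hs => ((hS s).1 ((hc s).1 hs)).1, fun i hi => ?_⟩
  have hex : ∃ s, η i ≤ s ∧ s ≤ i ∧ S s := by
    by_cases hSi : S i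
    · exact ⟨i, h i hi, le_rfl, hSi⟩
    · rw [hS i] at hSi
      push Not at hSi
      obtain ⟨s, ⟨h1, h2⟩, h3⟩ := hSi hi
      exact ⟨s, h1, h2.le, h3⟩
  obtain ⟨s, h1, h2, h3⟩ := hex
  have key : ∀ t t', η i ≤ t → t < t' → t' ≤ i → S t → ¬ S t' := by
    intro t t' h1 h2 h3 hSt hSt'
    have h4 := (hS t').1 hSt'
    exact h4.2 t ⟨(hη t' i h4.1 hi h3).trans h1, h2⟩ hSt
  refine (ne_of_unique_change h1 (Nat.lt_succ_of_le h2) ((hc s).2 h3) fun t h4 h5 h6 => ?_).symm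
  rcases lt_trichotomy t s with hts | hts | hts
  · exact absurd h3 (key t s h4 hts h2 ((hc t).1 h6))
  · exact hts
  · exact absurd ((hc t).1 h6) (key s t h1 hts (Nat.le_of_lt_succ h5) h3)

theorem exists_colour_of_lt (hη : ∀ i j, D i → D j → i ≤ j → η i ≤ η j)
    (hn : ∀ i, D i → η i ≤ n) (h : ∀ i, D i → i < η i) :
    ∃ c : ℕ → Bool, c 0 = false ∧ (∀ s, c s ≠ c (s + 1) → D s) ∧
      ∀ i, D i → c (η i) ≠ c i := by
  -- The same kernel construction towards later points; the bound `s < n` makes the measure `n - i`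
  -- decrease.
  obtain ⟨S, hS⟩ := exists_kernel (measure fun i => n - i).wf D
    (R := fun i s => i < s ∧ s < η i ∧ s < n) fun i s h => by
      change n - s < n - i
      omega
  obtain ⟨c, h0, hc⟩ := exists_colour S
  refine ⟨c, h0, fun s hs => ((hS s).1 ((hc s).1 hs)).1, fun i hi => ?_⟩
  have hex : ∃ s, i ≤ s ∧ s < η i ∧ S s := by
    by_cases hSi : S i
    · exact ⟨i, le_rfl, h i hi, hSi⟩
    · rw [hS i] at hSi
      push Not at hSi
      obtain ⟨s, ⟨h1, h2, -⟩, h3⟩ := hSi hi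
      exact ⟨s, h1.le, h2, h3⟩
  obtain ⟨s, h1, h2, h3⟩ := hex
  have key : ∀ t t', i ≤ t → t < t' → t' < η i → S t → ¬ S t' := by
    intro t t' h1 h2 h3 hSt hSt'
    have h4 := (hS t).1 hSt
    exact h4.2 t' ⟨h2, h3.trans_le (hη i t hi h4.1 h1), h3.trans_le (hn i hi)⟩ hSt'
  refine (ne_of_unique_change h1 h2 ((hc s).2 h3) fun t h4 h5 h6 => ?_).symm
  rcases lt_trichotomy t s with hts | hts | hts
  · exact absurd h3 (key t s h4 hts h2 ((hc t).1 h6))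
  · exact hts
  · exact absurd ((hc t).1 h6) (key s t h1 hts h5 h3)

end Colouring

/-- Pairs of colours, for the claims `η e ≤ e` and for the claims `e < η e`. -/
abbrev Colour : Type := Bool × Bool

/-- The local constraint on colours: `c'` and `c` are the colours before and after an event `e`,
`y` is the colour at a cut `η e` of the same process, and `b` claims that this cut is not after
`e`. -/
def ColourOk (c' c : Colour) (b : Prop) (y : Option Colour) : Prop :=
  (y = none → c = c' ∧ ¬ b) ∧ ∀ x, y = some x →
    (b → c.2 = c'.2 ∧ c.1 ≠ x.1) ∧ (¬ b → c.1 = c'.1 ∧ x.2 ≠ c'.2)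

namespace MSC

variable {P : Type u} {A : Type v} {M : MSC P A}

/-- The initial colours. -/
def colour₀ : P → Colour := fun _ => (false, false)

/-- A partial map from events to cuts of the same process is monotone on every process. -/
structure CutMap (M : MSC P A) (η : M.Event → Option ℕ) : Prop where
  mono : ∀ e e', e.1 = e'.1 → (e.2 : ℕ) ≤ e'.2 → ∀ k k', η e = some k → η e' = some k' → k ≤ k'
  le_len : ∀ e k, η e = some k → k ≤ M.len e.1

variable {η : M.Event → Option ℕ}

/-- The first colour excludes false claims and the second false denials. The values of `η` enter the
constraint only through colours; correctness comes from monotonicity. -/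
theorem CutMap.claim_iff (hη : M.CutMap η) {c : M.Event → Colour} {b : M.Event → Prop}
    (h : ∀ e, ColourOk (M.cutVal c colour₀ e.1 e.2) (c e) (b e)
      ((η e).map (M.cutVal c colour₀ e.1))) (e : M.Event) :
    b e ↔ ∃ k, η e = some k ∧ k ≤ e.2 := by
  obtain ⟨p, i, hi⟩ := e
  let cc : ℕ → Colour := M.cutVal c colour₀ p
  have hcc : ∀ j (hj : j < M.len p), cc (j + 1) = c ⟨p, ⟨j, hj⟩⟩ :=
    fun j hj => cutVal_succ c colour₀ (⟨p, ⟨j, hj⟩⟩ : M.Event)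
  -- The value `0` is a filler: the sets `D` below contain only positions where `η` is defined.
  let η' : ℕ → ℕ := fun j => if hj : j < M.len p then (η ⟨p, ⟨j, hj⟩⟩).getD 0 else 0
  have hη' : ∀ j (hj : j < M.len p) k, η ⟨p, ⟨j, hj⟩⟩ = some k → η' j = k := by
    intro j hj k hk
    change dite _ _ _ = k
    rw [dif_pos hj, hk]
    rfl
  have hmono : ∀ i j (hi : i < M.len p) (hj : j < M.len p), (∃ k, η ⟨p, ⟨i, hi⟩⟩ = some k) →
      (∃ k, η ⟨p, ⟨j, hj⟩⟩ = some k) → i ≤ j → η' i ≤ η' j := by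
    rintro i j hi hj ⟨k, hk⟩ ⟨k', hk'⟩ hij
    rw [hη' i hi k hk, hη' j hj k' hk']
    exact hη.mono ⟨p, ⟨i, hi⟩⟩ ⟨p, ⟨j, hj⟩⟩ rfl hij _ _ hk hk'
  have hA := Colouring.le_of_colour (n := M.len p) (η := η') (c := fun k => (cc k).1)
    (D := fun j => ∃ hj : j < M.len p, b ⟨p, ⟨j, hj⟩⟩ ∧ ∃ k, η ⟨p, ⟨j, hj⟩⟩ = some k)
    (by
      rintro i j ⟨hi, -, h1⟩ ⟨hj, -, h2⟩ hij
      exact hmono i j hi hj h1 h2 hij)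
    (by
      rintro i ⟨hi, -, k, hk⟩
      rw [hη' i hi k hk]
      exact hη.le_len _ _ hk)
    (by
      intro s hs hne
      rw [hcc s hs] at hne
      refine ⟨hs, ?_⟩
      have hs' := h ⟨p, ⟨s, hs⟩⟩
      cases hk : η ⟨p, ⟨s, hs⟩⟩ with
      | none =>
        exact absurd (congrArg Prod.fst (hs'.1 (by rw [hk]; rfl)).1.symm) hne
      | some k =>
        refine ⟨?_, k, rfl⟩
        by_contra hb
        exact hne ((hs'.2 _ (by rw [hk]; rfl)).2 hb).1.symm)
    (by
      rintro i ⟨hi, hb, k, hk⟩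
      rw [hcc i hi, hη' i hi k hk]
      exact (((h ⟨p, ⟨i, hi⟩⟩).2 _ (by rw [hk]; rfl)).1 hb).2)
  have hB := Colouring.lt_of_colour (n := M.len p) (η := η') (c := fun k => (cc k).2)
    (D := fun j => ∃ hj : j < M.len p, ¬ b ⟨p, ⟨j, hj⟩⟩ ∧ ∃ k, η ⟨p, ⟨j, hj⟩⟩ = some k)
    (by
      rintro i j ⟨hi, -, h1⟩ ⟨hj, -, h2⟩ hij
      exact hmono i j hi hj h1 h2 hij)
    (by
      rintro i ⟨hi, -⟩
      exact hi)
    (by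
      intro s hs hne
      rw [hcc s hs] at hne
      refine ⟨hs, ?_⟩
      have hs' := h ⟨p, ⟨s, hs⟩⟩
      cases hk : η ⟨p, ⟨s, hs⟩⟩ with
      | none =>
        exact absurd (congrArg Prod.snd (hs'.1 (by rw [hk]; rfl)).1.symm) hne
      | some k =>
        refine ⟨?_, k, rfl⟩
        intro hb
        exact hne ((hs'.2 _ (by rw [hk]; rfl)).1 hb).1.symm)
    (by
      rintro i ⟨hi, hb, k, hk⟩
      rw [hη' i hi k hk]
      exact (((h ⟨p, ⟨i, hi⟩⟩).2 _ (by rw [hk]; rfl)).2 hb).2)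
  cases hk : η ⟨p, ⟨i, hi⟩⟩ with
  | none =>
    simp only [reduceCtorEq, false_and, exists_false, iff_false]
    exact ((h ⟨p, ⟨i, hi⟩⟩).1 (by rw [hk]; rfl)).2
  | some k =>
    simp only [Option.some.injEq, exists_eq_left']
    constructor
    · intro hb
      have := hA i ⟨hi, hb, k, hk⟩
      rwa [hη' i hi k hk] at this
    · intro hle
      by_contra hb
      have := hB i ⟨hi, hb, k, hk⟩
      rw [hη' i hi k hk] at this
      omega

theorem CutMap.exists_colour (hη : M.CutMap η) :
    ∃ c : M.Event → Colour, ∀ e, ColourOk (M.cutVal c colour₀ e.1 e.2) (c e)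
      (∃ k, η e = some k ∧ k ≤ e.2) ((η e).map (M.cutVal c colour₀ e.1)) := by
  have key : ∀ p, ∃ cc : ℕ → Colour, cc 0 = (false, false) ∧
      ∀ i (hi : i < M.len p), ColourOk (cc i) (cc (i + 1))
        (∃ k, η ⟨p, ⟨i, hi⟩⟩ = some k ∧ k ≤ i) ((η ⟨p, ⟨i, hi⟩⟩).map cc) := by
    intro p
    let η' : ℕ → ℕ := fun j => if hj : j < M.len p then (η ⟨p, ⟨j, hj⟩⟩).getD 0 else 0
    have hη' : ∀ j (hj : j < M.len p) k, η ⟨p, ⟨j, hj⟩⟩ = some k → η' j = k := by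
      intro j hj k hk
      change dite _ _ _ = k
      rw [dif_pos hj, hk]
      rfl
    have hmono : ∀ i j (hi : i < M.len p) (hj : j < M.len p), (∃ k, η ⟨p, ⟨i, hi⟩⟩ = some k) →
        (∃ k, η ⟨p, ⟨j, hj⟩⟩ = some k) → i ≤ j → η' i ≤ η' j := by
      rintro i j hi hj ⟨k, hk⟩ ⟨k', hk'⟩ hij
      rw [hη' i hi k hk, hη' j hj k' hk']
      exact hη.mono ⟨p, ⟨i, hi⟩⟩ ⟨p, ⟨j, hj⟩⟩ rfl hij _ _ hk hk'
    obtain ⟨c1, h10, h11, h12⟩ := Colouring.exists_colour_of_le (η := η')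
      (D := fun j => ∃ hj : j < M.len p, ∃ k, η ⟨p, ⟨j, hj⟩⟩ = some k ∧ k ≤ j)
      (by
        rintro i j ⟨hi, k, h1, -⟩ ⟨hj, k', h2, -⟩ hij
        exact hmono i j hi hj ⟨k, h1⟩ ⟨k', h2⟩ hij)
      (by
        rintro i ⟨hi, k, hk, hle⟩
        rwa [hη' i hi k hk])
    obtain ⟨c2, h20, h21, h22⟩ := Colouring.exists_colour_of_lt (η := η') (n := M.len p)
      (D := fun j => ∃ hj : j < M.len p, ∃ k, η ⟨p, ⟨j, hj⟩⟩ = some k ∧ j < k)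
      (by
        rintro i j ⟨hi, k, h1, -⟩ ⟨hj, k', h2, -⟩ hij
        exact hmono i j hi hj ⟨k, h1⟩ ⟨k', h2⟩ hij)
      (by
        rintro i ⟨hi, k, hk, hle⟩
        rw [hη' i hi k hk]
        exact hη.le_len _ _ hk)
      (by
        rintro i ⟨hi, k, hk, hle⟩
        rwa [hη' i hi k hk])
    refine ⟨fun k => (c1 k, c2 k), Prod.ext h10 h20, fun i hi => ⟨fun hy => ?_, fun x hx => ?_⟩⟩
    · rw [Option.map_eq_none_iff] at hy
      rw [hy]
      simp only [reduceCtorEq, false_and, exists_false, not_false_eq_true, and_true,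
        Prod.mk.injEq]
      constructor
      · by_contra hne
        obtain ⟨_, k, hk, -⟩ := h11 i (Ne.symm hne)
        simp [hy] at hk
      · by_contra hne
        obtain ⟨_, k, hk, -⟩ := h21 i (Ne.symm hne)
        simp [hy] at hk
    · obtain ⟨k, hk, rfl⟩ := Option.map_eq_some_iff.1 hx
      have hek := hη' i hi k hk
      rw [hk]
      simp only [Option.some.injEq, exists_eq_left']
      constructor
      · intro hle
        constructor
        · by_contra hne
          obtain ⟨_, k', hk', hlt⟩ := h21 i (Ne.symm hne)
          rw [hk] at hk'
          cases hk'
          omega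
        · rw [← hek]
          exact h12 i ⟨hi, k, hk, hle⟩
      · intro hle
        constructor
        · by_contra hne
          obtain ⟨_, k', hk', hlt⟩ := h11 i (Ne.symm hne)
          rw [hk] at hk'
          cases hk'
          exact hle hlt
        · rw [← hek]
          exact h22 i ⟨hi, k, hk, by omega⟩
  choose cc h0 hcc using key
  have hcut : ∀ p k, k ≤ M.len p →
      M.cutVal (fun e : M.Event => cc e.1 (e.2 + 1)) colour₀ p k = cc p k := by
    intro p k hk
    cases k with
    | zero => exact (h0 p).symm
    | succ k => exact dif_pos hk
  refine ⟨fun e => cc e.1 (e.2 + 1), fun e => ?_⟩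
  have := hcc e.1 e.2 e.2.2
  rw [hcut _ _ e.2.2.le]
  convert this using 1
  change Option.map _ (η e) = Option.map _ (η e)
  cases hk : η e with
  | none => rfl
  | some k => exact congrArg some (hcut _ _ (hη.le_len _ _ hk))

end MSC

/-! ### Locally checked comparisons of events -/

/-- The information on one comparison task that is kept at an event: membership in the searched set,
colours before and after the event, the claim, the colour at the compared cut, and the auxiliary
values that are pulled along paths or along the process. -/
structure TaskLabel (P : Type u) : Type u where
  s : Prop
  d : Colour
  c : Colour
  b : Prop
  y : Option Colour
  V : MSC.Path P → Colour
  X : Option Colour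
  Z : MSC.Path P → Option Colour
  G : P → Option Colour

namespace MSC

variable {P : Type u} {A : Type v} {M : MSC P A}

/-- The local constraint `R` holds at the event `e` for the labelling `L`. -/
def LocalOk {T : Type*} (M : MSC P A)
    (R : P → T → Option T → Option T → Option (P × T) → Option (P × T) → Prop)
    (L : M.Event → T) (e : M.Event) : Prop :=
  R e.1 (L e) ((M.prev e).map L) ((M.next e).map L) ((M.rcv e).map fun f => (f.1, L f))
    ((M.snd e).map fun f => (f.1, L f))

/-- From `e` along `w` to process `q`, forward to the next event in `S`, and along `v` back to the
process of `e`. -/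
noncomputable def parCut (M : MSC P A) (S : M.Event → Prop) (q : P) (v w : List P)
    (e : M.Event) : Option ℕ :=
  open Classical in
  if pend q v = e.1 ∧ pend e.1 w = q then
    (M.nxt S q (M.lcut e.1 w (e.2 + 1))).map fun g => M.lcut q v (g.2 + 1)
  else none

/-- From `e` to the receive event of its message on process `r`, backward to the previous event in
`S`, and along `u` back to the process of `e`. -/
noncomputable def fwdCut (M : MSC P A) (S : M.Event → Prop) (r : P) (u : List P)
    (e : M.Event) : Option ℕ :=
  open Classical in
  (M.rcv e).bind fun f => if f.1 = r ∧ pend r u = e.1 then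
    (M.prv S r f.2).map fun g => M.lcut r u (g.2 + 1) else none

/-- From `e` to the receive event of its message on process `r`, along `u` back to the process of
`e`, and backward to the last event in `S`. -/
noncomputable def bwdCut (M : MSC P A) (S : M.Event → Prop) (r : P) (u : List P)
    (e : M.Event) : Option ℕ :=
  open Classical in
  (M.rcv e).bind fun f => if f.1 = r ∧ pend r u = e.1 then
    (M.prv S e.1 (M.lcut r u (f.2 + 1))).map fun g => (g.2 : ℕ) else none

variable {S : M.Event → Prop}

/-! ### Monotonicity of the compared cuts -/

theorem cutMap_parCut (q : P) (v w : List P) : M.CutMap (M.parCut S q v w) := by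
  constructor
  · intro e e' he hle k k' hk hk'
    unfold parCut at hk hk'
    split_ifs at hk hk'
    obtain ⟨g, hg, rfl⟩ := Option.map_eq_some_iff.1 hk
    obtain ⟨g', hg', rfl⟩ := Option.map_eq_some_iff.1 hk'
    have := (lcut_monotone (M := M) e.1 w (Nat.succ_le_succ hle)).trans_eq
      (congrArg (fun p => M.lcut p w (e'.2 + 1)) he)
    exact lcut_monotone _ _ (Nat.succ_le_succ (nxt_mono this hg hg'))
  · intro e k hk
    unfold parCut at hk
    split_ifs at hk with h
    obtain ⟨g, hg, rfl⟩ := Option.map_eq_some_iff.1 hk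
    obtain ⟨rfl, -⟩ := nxt_spec hg
    rw [← h.1]
    exact lcut_le_len _ _ g.2.2

theorem fwdCut_eq_some {r : P} {u : List P} {e : M.Event} {k : ℕ} :
    M.fwdCut S r u e = some k ↔ ∃ f g, M.msg e f ∧ f.1 = r ∧ pend r u = e.1 ∧
      M.prv S r f.2 = some g ∧ M.lcut r u (g.2 + 1) = k := by
  unfold fwdCut
  rw [Option.bind_eq_some_iff]
  constructor
  · rintro ⟨f, hf, h⟩
    split_ifs at h with h1
    obtain ⟨g, hg, rfl⟩ := Option.map_eq_some_iff.1 h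
    exact ⟨f, g, rcv_eq_some.1 hf, h1.1, h1.2, hg, rfl⟩
  · rintro ⟨f, g, hf, h1, h2, h3, rfl⟩
    refine ⟨f, rcv_eq_some.2 hf, ?_⟩
    rw [if_pos ⟨h1, h2⟩, h3]
    rfl

theorem bwdCut_eq_some {r : P} {u : List P} {e : M.Event} {k : ℕ} :
    M.bwdCut S r u e = some k ↔ ∃ f g, M.msg e f ∧ f.1 = r ∧ pend r u = e.1 ∧
      M.prv S e.1 (M.lcut r u (f.2 + 1)) = some g ∧ (g.2 : ℕ) = k := by
  unfold bwdCut
  rw [Option.bind_eq_some_iff]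
  constructor
  · rintro ⟨f, hf, h⟩
    split_ifs at h with h1
    obtain ⟨g, hg, rfl⟩ := Option.map_eq_some_iff.1 h
    exact ⟨f, g, rcv_eq_some.1 hf, h1.1, h1.2, hg, rfl⟩
  · rintro ⟨f, g, hf, h1, h2, h3, rfl⟩
    refine ⟨f, rcv_eq_some.2 hf, ?_⟩
    rw [if_pos ⟨h1, h2⟩, h3]
    rfl

theorem cutMap_fwdCut (r : P) (u : List P) : M.CutMap (M.fwdCut S r u) := by
  constructor
  · intro e e' he hle k k' hk hk'
    obtain ⟨f, g, h1, h2, h3, h4, rfl⟩ := fwdCut_eq_some.1 hk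
    obtain ⟨f', g', h1', h2', h3', h4', rfl⟩ := fwdCut_eq_some.1 hk'
    have := (fifo_le h1 h1' he (h2.trans h2'.symm)).1 hle
    exact lcut_monotone _ _ (Nat.succ_le_succ (prv_mono this h4 h4'))
  · intro e k hk
    obtain ⟨f, g, h1, h2, h3, h4, rfl⟩ := fwdCut_eq_some.1 hk
    rw [← h3]
    obtain ⟨rfl, -⟩ := prv_spec h4
    exact lcut_le_len _ _ g.2.2

theorem cutMap_bwdCut (r : P) (u : List P) : M.CutMap (M.bwdCut S r u) := by
  constructor
  · intro e e' he hle k k' hk hk'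
    obtain ⟨f, g, h1, h2, h3, h4, rfl⟩ := bwdCut_eq_some.1 hk
    obtain ⟨f', g', h1', h2', h3', h4', rfl⟩ := bwdCut_eq_some.1 hk'
    have := (fifo_le h1 h1' he (h2.trans h2'.symm)).1 hle
    rw [← he] at h4'
    exact prv_mono (lcut_monotone _ _ (Nat.succ_le_succ this)) h4 h4'
  · intro e k hk
    obtain ⟨f, g, h1, h2, h3, h4, rfl⟩ := bwdCut_eq_some.1 hk
    rw [← (prv_spec h4).1]
    exact g.2.2.le

variable (M) in
/-- The colour of the cut of `u` at `e`. -/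
noncomputable def pulledColour (c : M.Event → Colour) (u : Path P) (g : M.Event) : Colour :=
  M.pulled c colour₀ g u.1

/-- A search starting at cut `k + 1` can be attached to event `k`, as the search from its successor.
No event precedes cut `0`, so its search result has to be supplied as an initial value. -/
theorem cutVal_nxt {V : Type*} (φ : M.Event → V) {q : P} {k : ℕ} (hk : k ≤ M.len q) :
    M.cutVal (fun e => (M.next e).bind fun x => (M.nxt S x.1 x.2).map φ)
      (fun q => (M.nxt S q 0).map φ) q k = (M.nxt S q k).map φ := by
  cases k with
  | zero => rfl
  | succ k =>
    refine (dif_pos hk).trans ?_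
    have := nxt_succ S (⟨q, ⟨k, hk⟩⟩ : M.Event)
    simp only at this
    rw [this, Option.map_bind]
    rfl

theorem cutVal_prv {V : Type*} (φ : M.Event → V) {q : P} {k : ℕ} (hk : k ≤ M.len q) :
    M.cutVal (fun e => (M.prv S e.1 (e.2 + 1)).map φ) (fun _ => none) q k =
      (M.prv S q k).map φ := by
  cases k with
  | zero => rfl
  | succ k => exact dif_pos hk

theorem pulled_nxt {V : Type*} (φ : M.Event → V) (e : M.Event) (u : List P) :
    M.pulled (fun e => (M.next e).bind fun x => (M.nxt S x.1 x.2).map φ)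
      (fun q => (M.nxt S q 0).map φ) e u =
      (M.nxt S (pend e.1 u) (M.lcut e.1 u (e.2 + 1))).map φ :=
  cutVal_nxt φ (lcut_le_len _ _ e.2.2)

theorem pulled_prv {V : Type*} (φ : M.Event → V) (e : M.Event) (u : List P) :
    M.pulled (fun e => (M.prv S e.1 (e.2 + 1)).map φ) (fun _ => none) e u =
      (M.prv S (pend e.1 u) (M.lcut e.1 u (e.2 + 1))).map φ :=
  cutVal_prv φ (lcut_le_len _ _ e.2.2)

/-- Local constraints for the comparison of `e` with `parCut`. -/
structure ParOk (q : P) (v w : Path P) (p : P) (l : TaskLabel P) (prev next : Option (TaskLabel P))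
    (_rcv snd : Option (P × TaskLabel P)) : Prop where
  d : l.d = (prev.map TaskLabel.c).elim (colour₀ p) id
  V : PullOk l.V (prev.map TaskLabel.V) (snd.map fun x => (x.1, x.2.V)) l.c colour₀
  X : (l.s → l.X = some (l.V v)) ∧ (¬ l.s → l.X = next.bind TaskLabel.X)
  Z : PullOk l.Z (prev.map TaskLabel.Z) (snd.map fun x => (x.1, x.2.Z)) (next.bind TaskLabel.X) l.G
  -- `G` guesses the search results at the cuts `0` of all processes. Each process verifies its own
  -- component at its first event; constancy along processes and the acceptance condition make the
  -- guesses agree.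
  G_first : prev = none → l.G p = l.X
  G_step : ∀ l', prev = some l' → l'.G = l.G
  y : (pend q v.1 = p ∧ pend p w.1 = q → l.y = l.Z w) ∧
    (¬ (pend q v.1 = p ∧ pend p w.1 = q) → l.y = none)
  c : ColourOk l.d l.c l.b l.y

open Classical in
/-- Local constraints for the comparison of `e` with `fwdCut`. -/
structure FwdOk (r : P) (u : Path P) (p : P) (l : TaskLabel P) (prev _next : Option (TaskLabel P))
    (rcv snd : Option (P × TaskLabel P)) : Prop where
  d : l.d = (prev.map TaskLabel.c).elim (colour₀ p) id
  V : PullOk l.V (prev.map TaskLabel.V) (snd.map fun x => (x.1, x.2.V)) l.c colour₀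
  X : l.X = prev.bind fun l' => if l'.s then some (l'.V u) else l'.X
  y : l.y = rcv.bind fun x => if x.1 = r ∧ pend r u.1 = p then x.2.X else none
  c : ColourOk l.d l.c l.b l.y

open Classical in
/-- Local constraints for the comparison of `e` with `bwdCut`. -/
structure BwdOk (r : P) (u : Path P) (p : P) (l : TaskLabel P) (prev _next : Option (TaskLabel P))
    (rcv snd : Option (P × TaskLabel P)) : Prop where
  d : l.d = (prev.map TaskLabel.c).elim (colour₀ p) id
  X : l.X = prev.bind fun l' => if l'.s then some l'.d else l'.X
  Z : PullOk l.Z (prev.map TaskLabel.Z) (snd.map fun x => (x.1, x.2.Z))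
    (if l.s then some l.d else l.X) fun _ => none
  y : l.y = rcv.bind fun x => if x.1 = r ∧ pend r u.1 = p then x.2.Z u else none
  c : ColourOk l.d l.c l.b l.y

/-! ### Soundness and completeness of the comparison tasks -/

variable {L : M.Event → TaskLabel P}

theorem prev_colour (c : M.Event → Colour) (e : M.Event) :
    ((M.prev e).map c).elim (colour₀ e.1) id = M.cutVal c colour₀ e.1 e.2 := by
  rw [cutVal_self]
  cases M.prev e <;> rfl

theorem map_nxt_pulledColour (c : M.Event → Colour) {q p : P} {v : Path P} (hv : pend q v.1 = p)
    (k : ℕ) : (M.nxt S q k).map (M.pulledColour c v) =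
      ((M.nxt S q k).map fun g => M.lcut q v.1 (g.2 + 1)).map (M.cutVal c colour₀ p) := by
  cases h : M.nxt S q k with
  | none => rfl
  | some g =>
    obtain ⟨rfl, -⟩ := nxt_spec h
    subst hv
    rfl

theorem map_prv_pulledColour (c : M.Event → Colour) {q p : P} {v : Path P} (hv : pend q v.1 = p)
    (k : ℕ) : (M.prv S q k).map (M.pulledColour c v) =
      ((M.prv S q k).map fun g => M.lcut q v.1 (g.2 + 1)).map (M.cutVal c colour₀ p) := by
  cases h : M.prv S q k with
  | none => rfl
  | some g =>
    obtain ⟨rfl, -⟩ := prv_spec h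
    subst hv
    rfl

theorem map_prv_colour (c : M.Event → Colour) (q : P) (k : ℕ) :
    (M.prv S q k).map (fun g => M.cutVal c colour₀ g.1 g.2) =
      ((M.prv S q k).map fun g => (g.2 : ℕ)).map (M.cutVal c colour₀ q) := by
  cases h : M.prv S q k with
  | none => rfl
  | some g =>
    obtain ⟨rfl, -⟩ := prv_spec h
    rfl

/-- Given the colours `c`, the fields `d`, `V`, `X`, `G`, `Z`, `y` are determined in this order, so
`y` is the true colour at the compared cut and `CutMap.claim_iff` applies. A process without events
cannot check its component of `G`, hence `hG₀`. -/
theorem par_claim_iff {q : P} {v w : Path P} (h : ∀ e, M.LocalOk (ParOk q v w) L e)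
    (hs : ∀ e, (L e).s ↔ S e) {G : P → Option Colour} (hG : ∀ e, (L e).G = G)
    (hG₀ : ∀ p, M.len p = 0 → G p = none) (e : M.Event) :
    (L e).b ↔ ∃ k, M.parCut S q v.1 w.1 e = some k ∧ k ≤ e.2 := by
  obtain rfl : S = fun e => (L e).s := funext fun e => propext (hs e).symm
  set S : M.Event → Prop := fun e => (L e).s
  set c : M.Event → Colour := fun e => (L e).c with hc
  have hd : ∀ e, (L e).d = M.cutVal c colour₀ e.1 e.2 := fun e => by
    rw [(h e).d, Option.map_map]
    exact prev_colour c e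
  have hV : ∀ e u, (L e).V u = M.pulledColour c u e := by
    refine pullOk_iff.1 fun e => ?_
    have := (h e).V
    simpa only [Option.map_map, Function.comp_def] using this
  have hX : ∀ e, (L e).X = (M.nxt S e.1 e.2).map (M.pulledColour c v) := by
    refine nxt_map_iff.1 fun e => ?_
    have := (h e).X
    rw [hV, Option.bind_map] at this
    exact this
  have hGn : G = fun q => (M.nxt S q 0).map (M.pulledColour c v) := by
    funext q
    rcases Nat.eq_zero_or_pos (M.len q) with hq | hq
    · rw [hG₀ q hq, nxt_eq_none hq.le]
      rfl
    · have := (h ⟨q, ⟨0, hq⟩⟩).G_first (by rw [prev_zero]; rfl)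
      rw [hG, hX] at this
      exact this
  have hZ : ∀ e u, (L e).Z u =
      (M.nxt S (pend e.1 u.1) (M.lcut e.1 u.1 (e.2 + 1))).map (M.pulledColour c v) := by
    intro e u
    rw [← pulled_nxt]
    refine (pullOk_iff (F := fun e => (L e).Z)).1 (fun e => ?_) e u
    have := (h e).Z
    simp only [Option.map_map, Function.comp_def, Option.bind_map, hX, hG] at this
    rw [hGn] at this
    exact this
  refine (cutMap_parCut (S := S) q v.1 w.1).claim_iff (c := c) (b := fun e => (L e).b)
    (fun e => ?_) e
  have h1 := (h e).c
  have h2 : (L e).y = (M.parCut S q v.1 w.1 e).map (M.cutVal c colour₀ e.1) := by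
    unfold parCut
    split_ifs with hp
    · rw [(h e).y.1 hp, hZ, hp.2]
      exact map_nxt_pulledColour c hp.1 _
    · rw [(h e).y.2 hp]
      rfl
  rwa [hd, h2] at h1

theorem exists_parOk (S : M.Event → Prop) (q : P) (v w : Path P) :
    ∃ (L : M.Event → TaskLabel P) (G : P → Option Colour), (∀ e, M.LocalOk (ParOk q v w) L e) ∧
      (∀ e, (L e).s ↔ S e) ∧ (∀ e, (L e).G = G) ∧ ∀ p, M.len p = 0 → G p = none := by
  obtain ⟨c, hc⟩ := (cutMap_parCut (S := S) q v.1 w.1).exists_colour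
  let L : M.Event → TaskLabel P := fun e =>
    { s := S e
      d := M.cutVal c colour₀ e.1 e.2
      c := c e
      b := ∃ k, M.parCut S q v.1 w.1 e = some k ∧ k ≤ e.2
      y := (M.parCut S q v.1 w.1 e).map (M.cutVal c colour₀ e.1)
      V := fun u => M.pulledColour c u e
      X := (M.nxt S e.1 e.2).map (M.pulledColour c v)
      Z := fun u =>
        (M.nxt S (pend e.1 u.1) (M.lcut e.1 u.1 (e.2 + 1))).map (M.pulledColour c v)
      G := fun q => (M.nxt S q 0).map (M.pulledColour c v) }
  refine ⟨L, _, fun e => ?_, fun _ => Iff.rfl, fun _ => rfl, fun p hp => ?_⟩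
  · constructor
    · rw [Option.map_map]
      exact (prev_colour c e).symm
    · simp only [Option.map_map, Function.comp_def]
      exact (pullOk_iff (F := fun e => (L e).V)).2 (fun _ _ => rfl) e
    · have := (nxt_map_iff (X := fun e => (L e).X) (S := S) (g := M.pulledColour c v)).2
        (fun _ => rfl) e
      rw [Option.bind_map]
      exact this
    · simp only [Option.map_map, Function.comp_def, Option.bind_map]
      exact (pullOk_iff (F := fun e => (L e).Z)).2 (fun e u => (pulled_nxt _ e u.1).symm) e
    · intro hprev
      rw [Option.map_eq_none_iff, prev_eq_none] at hprev
      change Option.map _ _ = Option.map _ _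
      rw [hprev]
    · intro l' hl'
      obtain ⟨x, -, rfl⟩ := Option.map_eq_some_iff.1 hl'
      rfl
    · constructor
      · intro hp
        change Option.map _ _ = Option.map _ _
        unfold parCut
        rw [if_pos hp, hp.2]
        exact (map_nxt_pulledColour c hp.1 _).symm
      · intro hp
        change Option.map _ _ = _
        unfold parCut
        rw [if_neg hp]
        rfl
    · exact hc e
  · rw [nxt_eq_none hp.le]
    rfl

theorem fwdCut_map (c : M.Event → Colour) (r : P) (u : Path P) (e : M.Event) :
    (M.fwdCut S r u.1 e).map (M.cutVal c colour₀ e.1) =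
      open Classical in (M.rcv e).bind fun f => if f.1 = r ∧ pend r u.1 = e.1 then
        (M.prv S f.1 f.2).map (M.pulledColour c u) else none := by
  unfold fwdCut
  rw [Option.map_bind]
  congr 1
  funext f
  simp only [Function.comp_apply]
  split_ifs with h
  · obtain ⟨p, j⟩ := f
    obtain rfl : p = r := h.1
    exact (map_prv_pulledColour c h.2 _).symm
  · rfl

theorem bwdCut_map (c : M.Event → Colour) (r : P) (u : Path P) (e : M.Event) :
    (M.bwdCut S r u.1 e).map (M.cutVal c colour₀ e.1) =
      open Classical in (M.rcv e).bind fun f => if f.1 = r ∧ pend r u.1 = e.1 then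
        (M.prv S (pend f.1 u.1) (M.lcut f.1 u.1 (f.2 + 1))).map
          (fun g => M.cutVal c colour₀ g.1 g.2) else none := by
  unfold bwdCut
  rw [Option.map_bind]
  congr 1
  funext f
  simp only [Function.comp_apply]
  split_ifs with h
  · obtain ⟨p, j⟩ := f
    obtain rfl : p = r := h.1
    simp only [h.2]
    exact (map_prv_colour c _ _).symm
  · rfl

/-- Types use denials of the claim at existing cuts. Since the claim also fails when there is no
cut, definedness of the cut is certified separately through `y`. -/
theorem fwd_claim_iff {r : P} {u : Path P} (h : ∀ e, M.LocalOk (FwdOk r u) L e)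
    (hs : ∀ e, (L e).s ↔ S e) (e : M.Event) :
    ((L e).y = none ↔ M.fwdCut S r u.1 e = none) ∧
      ((L e).b ↔ ∃ k, M.fwdCut S r u.1 e = some k ∧ k ≤ e.2) := by
  obtain rfl : S = fun e => (L e).s := funext fun e => propext (hs e).symm
  set S : M.Event → Prop := fun e => (L e).s
  set c : M.Event → Colour := fun e => (L e).c with hc
  have hd : ∀ e, (L e).d = M.cutVal c colour₀ e.1 e.2 := fun e => by
    rw [(h e).d, Option.map_map]
    exact prev_colour c e
  have hV : ∀ e u, (L e).V u = M.pulledColour c u e := by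
    refine pullOk_iff.1 fun e => ?_
    have := (h e).V
    simpa only [Option.map_map, Function.comp_def] using this
  have hX : ∀ e, (L e).X = (M.prv S e.1 e.2).map (M.pulledColour c u) := by
    refine prv_map_iff.1 fun e => ?_
    have := (h e).X
    simpa only [Option.bind_map, Function.comp_def, hV] using this
  have hy : ∀ e, (L e).y = (M.fwdCut S r u.1 e).map (M.cutVal c colour₀ e.1) := by
    intro e
    rw [fwdCut_map, (h e).y]
    simp only [Option.bind_map, Function.comp_def, hX]
  refine ⟨by rw [hy, Option.map_eq_none_iff], ?_⟩
  refine (cutMap_fwdCut (S := S) r u.1).claim_iff (c := c) (b := fun e => (L e).b)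
    (fun e => ?_) e
  have h1 := (h e).c
  rwa [hd, hy] at h1

theorem exists_fwdOk (S : M.Event → Prop) (r : P) (u : Path P) :
    ∃ L : M.Event → TaskLabel P, (∀ e, M.LocalOk (FwdOk r u) L e) ∧ ∀ e, (L e).s ↔ S e := by
  obtain ⟨c, hc⟩ := (cutMap_fwdCut (S := S) r u.1).exists_colour
  let L : M.Event → TaskLabel P := fun e =>
    { s := S e
      d := M.cutVal c colour₀ e.1 e.2
      c := c e
      b := ∃ k, M.fwdCut S r u.1 e = some k ∧ k ≤ e.2
      y := (M.fwdCut S r u.1 e).map (M.cutVal c colour₀ e.1)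
      V := fun u => M.pulledColour c u e
      X := (M.prv S e.1 e.2).map (M.pulledColour c u)
      Z := fun _ => none
      G := fun _ => none }
  refine ⟨L, fun e => ?_, fun _ => Iff.rfl⟩
  constructor
  · rw [Option.map_map]
    exact (prev_colour c e).symm
  · simp only [Option.map_map, Function.comp_def]
    exact (pullOk_iff (F := fun e => (L e).V)).2 (fun _ _ => rfl) e
  · rw [Option.bind_map]
    exact (prv_map_iff (X := fun e => (L e).X)).2 (fun _ => rfl) e
  · rw [Option.bind_map]
    exact fwdCut_map c r u e
  · exact hc e

/-- The compared cut lies before the event found, so the transported colour is `d` rather than `c`,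
and a denial at an existing cut says that `e` strictly precedes that event. -/
theorem bwd_claim_iff {r : P} {u : Path P} (h : ∀ e, M.LocalOk (BwdOk r u) L e)
    (hs : ∀ e, (L e).s ↔ S e) (e : M.Event) :
    ((L e).y = none ↔ M.bwdCut S r u.1 e = none) ∧
      ((L e).b ↔ ∃ k, M.bwdCut S r u.1 e = some k ∧ k ≤ e.2) := by
  classical
  obtain rfl : S = fun e => (L e).s := funext fun e => propext (hs e).symm
  set S : M.Event → Prop := fun e => (L e).s
  set c : M.Event → Colour := fun e => (L e).c with hc
  have hd : ∀ e, (L e).d = M.cutVal c colour₀ e.1 e.2 := fun e => by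
    rw [(h e).d, Option.map_map]
    exact prev_colour c e
  have hX : ∀ e, (L e).X = (M.prv S e.1 e.2).map fun g => M.cutVal c colour₀ g.1 g.2 := by
    refine prv_map_iff.1 fun e => ?_
    have := (h e).X
    simpa only [Option.bind_map, Function.comp_def, hd] using this
  have hX' : ∀ e, (if (L e).s then some (L e).d else (L e).X) =
      (M.prv S e.1 (e.2 + 1)).map fun g => M.cutVal c colour₀ g.1 g.2 := by
    intro e
    rw [prv_succ, hd, hX]
    split_ifs <;> rfl
  have hZ : ∀ e u, (L e).Z u = (M.prv S (pend e.1 u.1) (M.lcut e.1 u.1 (e.2 + 1))).map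
      fun g => M.cutVal c colour₀ g.1 g.2 := by
    intro e u
    rw [← pulled_prv]
    refine (pullOk_iff (F := fun e => (L e).Z)).1 (fun e => ?_) e u
    have := (h e).Z
    simp only [Option.map_map, Function.comp_def] at this
    convert this using 1
    rw [← hX']
  have hy : ∀ e, (L e).y = (M.bwdCut S r u.1 e).map (M.cutVal c colour₀ e.1) := by
    intro e
    rw [bwdCut_map, (h e).y]
    simp only [Option.bind_map, Function.comp_def, hZ]
  refine ⟨by rw [hy, Option.map_eq_none_iff], ?_⟩
  refine (cutMap_bwdCut (S := S) r u.1).claim_iff (c := c) (b := fun e => (L e).b)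
    (fun e => ?_) e
  have h1 := (h e).c
  rwa [hd, hy] at h1

theorem exists_bwdOk (S : M.Event → Prop) (r : P) (u : Path P) :
    ∃ L : M.Event → TaskLabel P, (∀ e, M.LocalOk (BwdOk r u) L e) ∧ ∀ e, (L e).s ↔ S e := by
  classical
  obtain ⟨c, hc⟩ := (cutMap_bwdCut (S := S) r u.1).exists_colour
  let L : M.Event → TaskLabel P := fun e =>
    { s := S e
      d := M.cutVal c colour₀ e.1 e.2
      c := c e
      b := ∃ k, M.bwdCut S r u.1 e = some k ∧ k ≤ e.2
      y := (M.bwdCut S r u.1 e).map (M.cutVal c colour₀ e.1)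
      V := fun _ => (false, false)
      X := (M.prv S e.1 e.2).map fun g => M.cutVal c colour₀ g.1 g.2
      Z := fun u => (M.prv S (pend e.1 u.1) (M.lcut e.1 u.1 (e.2 + 1))).map
        fun g => M.cutVal c colour₀ g.1 g.2
      G := fun _ => none }
  refine ⟨L, fun e => ?_, fun _ => Iff.rfl⟩
  constructor
  · rw [Option.map_map]
    exact (prev_colour c e).symm
  · rw [Option.bind_map]
    convert (prv_map_iff (X := fun e => (L e).X) (S := S)
      (g := fun g => M.cutVal c colour₀ g.1 g.2)).2 (fun _ => rfl) e
    rfl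
  · simp only [Option.map_map, Function.comp_def]
    convert (pullOk_iff (F := fun e => (L e).Z)).2 (fun e u => (pulled_prv _ e u.1).symm) e
      using 1
    rw [prv_succ]
    split_ifs <;> rfl
  · rw [Option.bind_map]
    exact bwdCut_map c r u e
  · exact hc e

end MSC

/-! ### Types in terms of cuts -/

namespace MSC

variable {P : Type u} {A : Type v} (M : MSC P A)

/-- The events with letter `a`. -/
def HasLetter (a : A) (e : M.Event) : Prop := M.letterAt e = a

/-- The labels of the future of `e`, including `e`. -/
def future (e : M.Event) : Set (P × A) := {l | ∃ f, M.le e f ∧ M.label f = l}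

/-- The labels of the future of the next event. -/
def futureNext (e : M.Event) : Set (P × A) := {l | ∃ x, M.proc e x ∧ l ∈ M.future x}

/-- The labels of the past of `e`, including `e`. -/
def past (e : M.Event) : Set (P × A) := {l | ∃ f, M.le f e ∧ M.label f = l}

/-- The labels of the past of the previous event. -/
def pastPrev (e : M.Event) : Set (P × A) := {l | ∃ x, M.proc x e ∧ l ∈ M.past x}

variable {M}

theorem label_eq_iff {f : M.Event} {q : P} {a : A} :
    M.label f = (q, a) ↔ f.1 = q ∧ M.HasLetter a f := Prod.mk_inj

theorem future_eq (e : M.Event) : M.future e =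
    {l | l = M.label e ∨ l ∈ M.futureNext e ∨ ∃ x, M.msg e x ∧ l ∈ M.future x} := by
  ext l
  constructor
  · rintro ⟨f, hf, rfl⟩
    rcases Relation.ReflTransGen.cases_head hf with rfl | ⟨x, hx | hx, hxf⟩
    · exact Or.inl rfl
    · exact Or.inr (Or.inl ⟨x, hx, f, hxf, rfl⟩)
    · exact Or.inr (Or.inr ⟨x, hx, f, hxf, rfl⟩)
  · rintro (rfl | ⟨x, hx, f, hxf, rfl⟩ | ⟨x, hx, f, hxf, rfl⟩)
    · exact ⟨e, Relation.ReflTransGen.refl, rfl⟩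
    · exact ⟨f, hxf.head (Or.inl hx), rfl⟩
    · exact ⟨f, hxf.head (Or.inr hx), rfl⟩

theorem past_eq (e : M.Event) : M.past e =
    {l | l = M.label e ∨ l ∈ M.pastPrev e ∨ ∃ x, M.msg x e ∧ l ∈ M.past x} := by
  ext l
  constructor
  · rintro ⟨f, hf, rfl⟩
    rcases Relation.ReflTransGen.cases_tail hf with rfl | ⟨x, hxf, hx | hx⟩
    · exact Or.inl rfl
    · exact Or.inr (Or.inl ⟨x, hx, f, hxf, rfl⟩)
    · exact Or.inr (Or.inr ⟨x, hx, f, hxf, rfl⟩)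
  · rintro (rfl | ⟨x, hx, f, hxf, rfl⟩ | ⟨x, hx, f, hxf, rfl⟩)
    · exact ⟨e, Relation.ReflTransGen.refl, rfl⟩
    · exact ⟨f, hxf.tail (Or.inl hx), rfl⟩
    · exact ⟨f, hxf.tail (Or.inr hx), rfl⟩

theorem exists_proc_of_lt {e f : M.Event} (h : e.1 = f.1) (hlt : (e.2 : ℕ) < f.2) :
    ∃ x, M.proc e x ∧ M.le x f := by
  have := f.2.2
  have h' := congrArg M.len h
  exact ⟨⟨e.1, ⟨e.2 + 1, by omega⟩⟩, ⟨rfl, rfl⟩, le_of_proc_le h hlt⟩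

theorem exists_proc_of_gt {e f : M.Event} (h : f.1 = e.1) (hlt : (f.2 : ℕ) < e.2) :
    ∃ x, M.proc x e ∧ M.le f x := by
  have := e.2.2
  refine ⟨⟨e.1, ⟨e.2 - 1, by omega⟩⟩, ⟨rfl, ?_⟩, le_of_proc_le h ?_⟩ <;> simp only <;> omega

variable [Finite P]

/-- Claims for all `w` place the candidate beyond the past of `e`; claims for all `v` say that it is
not above `e`. The first candidate beyond the past suffices: if it is above `e`, so are all later
ones on `q`. -/
theorem mem_type_parallel {e : M.Event} {q : P} {a : A} :
    (q, a) ∈ M.typeOf e .parallel ↔ q ≠ e.1 ∧ ∀ v w : Path P, pend q v.1 = e.1 →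
      pend e.1 w.1 = q → ∃ k, M.parCut (M.HasLetter a) q v.1 w.1 e = some k ∧ k ≤ e.2 := by
  constructor
  · rintro ⟨f, ⟨h1, h2⟩, hf⟩
    obtain ⟨rfl, ha⟩ := label_eq_iff.1 hf
    constructor
    · intro he
      rcases le_total (f.2 : ℕ) e.2 with h | h
      · exact h2 (le_of_proc_le he h)
      · exact h1 (le_of_proc_le he.symm h)
    · intro v w hv hw
      have h3 : M.lcut e.1 w.1 (e.2 + 1) ≤ f.2 := by
        by_contra! h
        exact h2 (le_of_lt_lcut hw h)
      obtain ⟨g, hg, hgf⟩ := exists_nxt ha h3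
      refine ⟨_, by unfold parCut; rw [if_pos ⟨hv, hw⟩, hg]; rfl, ?_⟩
      refine (lcut_monotone _ _ (Nat.succ_le_succ hgf)).trans ?_
      by_contra! h
      exact h1 (le_of_lt_lcut hv h)
  · rintro ⟨hq, h⟩
    obtain ⟨v₀, hv₀⟩ := exists_path q e.1
    have hfin : Finite (Path P) := (List.finite_length_le P (Nat.card P)).to_subtype
    obtain ⟨w₀, hw₀⟩ := exists_path e.1 q
    -- The largest of the finitely many cuts delimits the whole past of `e` on `q`.
    obtain ⟨w, hw, hmax⟩ := Set.exists_max_image {w : Path P | pend e.1 w.1 = q}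
      (fun w => M.lcut e.1 w.1 (e.2 + 1)) (Set.toFinite _) ⟨w₀, hw₀⟩
    obtain ⟨k, hk, -⟩ := h v₀ w hv₀ hw
    unfold parCut at hk
    rw [if_pos ⟨hv₀, hw⟩] at hk
    obtain ⟨g, hg, -⟩ := Option.map_eq_some_iff.1 hk
    obtain ⟨rfl, h2, h3⟩ := nxt_spec hg
    refine ⟨g, ⟨fun hle => ?_, fun hle => ?_⟩, label_eq_iff.2 ⟨rfl, h3⟩⟩
    · obtain ⟨v, hv, hlt⟩ := le_iff_exists_path.1 hle
      obtain ⟨k', hk', hle'⟩ := h v w hv hw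
      unfold parCut at hk'
      rw [if_pos ⟨hv, hw⟩, hg] at hk'
      cases hk'
      exact absurd hle' (not_le.2 hlt)
    · obtain ⟨w', hw', hlt⟩ := le_iff_exists_path.1 hle
      exact absurd (hlt.trans_le ((hmax w' hw').trans h2)) (Nat.lt_irrefl _)

/-- On the own process the target lies beyond the next event; on a process without the receive event
`f`, any future event qualifies. On the process of `f` it lies beyond `f` or before it. In the
latter case it may be replaced by the last event with this letter before `f`, so one comparison per
path decides. -/
theorem mem_type_strictLess {e : M.Event} {q : P} {a : A} :
    (q, a) ∈ M.typeOf e .strictLess ↔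
      (q = e.1 ∧ ∃ x, M.proc e x ∧ (q, a) ∈ M.futureNext x) ∨
      (q ≠ e.1 ∧ (∀ f, M.msg e f → f.1 ≠ q) ∧ (q, a) ∈ M.future e) ∨
      ∃ f, M.msg e f ∧ f.1 = q ∧ ((q, a) ∈ M.futureNext f ∨
        ∃ u : Path P, M.fwdCut (M.HasLetter a) q u.1 e ≠ none ∧
          ¬ ∃ k, M.fwdCut (M.HasLetter a) q u.1 e = some k ∧ k ≤ e.2) := by
  constructor
  · rintro ⟨g, ⟨hlt, hn⟩, hg⟩
    obtain ⟨rfl, ha⟩ := label_eq_iff.1 hg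
    push Not at hn
    by_cases hq : g.1 = e.1
    · left
      have h1 := (lt_iff_of_eq hq.symm).1 hlt
      obtain ⟨x, hx, hxg⟩ := exists_proc_of_lt hq.symm h1
      have h2 := proc_iff.1 hx
      have h3 : (x.2 : ℕ) < g.2 := by
        refine Nat.lt_of_le_of_ne ((le_iff_of_eq (h2.1.symm.trans hq.symm)).1 hxg) fun h => ?_
        exact hn.1 (proc_iff.2 ⟨hq.symm, h2.2.trans h⟩)
      obtain ⟨y, hy, hyg⟩ := exists_proc_of_lt (h2.1.symm.trans hq.symm) h3
      exact ⟨hq, x, hx, y, hy, g, hyg, hg⟩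
    by_cases hf : ∃ f, M.msg e f ∧ f.1 = g.1
    · right; right
      obtain ⟨f, hef, hfg⟩ := hf
      refine ⟨f, hef, hfg, ?_⟩
      rcases lt_trichotomy (f.2 : ℕ) g.2 with h | h | h
      · obtain ⟨x, hx, hxg⟩ := exists_proc_of_lt hfg h
        exact Or.inl ⟨x, hx, g, hxg, hg⟩
      · exact absurd hef (event_ext hfg h ▸ hn.2)
      · right
        obtain ⟨g', hg', hle⟩ := exists_prv ha h
        obtain ⟨h1, h2, h3⟩ := prv_spec hg'
        obtain ⟨u, hu, hlt'⟩ := le_iff_exists_path.1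
          (le_trans (le_of_lt hlt) (le_of_proc_le h1.symm hle))
        rw [show pend g'.1 u.1 = pend g.1 u.1 from congrArg (fun p => pend p u.1) h1] at hu
        have hlt'' := hlt'.trans_eq (congrArg (fun p => M.lcut p u.1 (g'.2 + 1)) h1)
        have hk : M.fwdCut (M.HasLetter a) g.1 u.1 e = some (M.lcut g.1 u.1 (g'.2 + 1)) :=
          fwdCut_eq_some.2 ⟨f, g', hef, hfg, hu, hg', rfl⟩
        refine ⟨u, by rw [hk]; exact Option.some_ne_none _, ?_⟩
        rintro ⟨k, hk', hle'⟩
        rw [hk] at hk'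
        cases hk'
        exact absurd hle' (not_le.2 hlt'')
    · right; left
      push Not at hf
      exact ⟨hq, hf, g, le_of_lt hlt, hg⟩
  · rintro (⟨rfl, x, hx, y, hy, g, hyg, hg⟩ | ⟨hq, hf, g, heg, hg⟩ |
      ⟨f, hef, rfl, ⟨x, hx, g, hxg, hg⟩ | ⟨u, hne, hu⟩⟩)
    · obtain ⟨h1, ha⟩ := label_eq_iff.1 hg
      have hx' := proc_iff.1 hx
      have hy' := proc_iff.1 hy
      have := (le_iff_of_eq (hy'.1.symm.trans (hx'.1.symm.trans h1.symm))).1 hyg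
      refine ⟨g, ⟨lt_of_pos_lt h1.symm (by omega), ?_⟩, hg⟩
      rintro (h | h)
      · have := (proc_iff.1 h).2
        omega
      · exact M.msg_ne _ _ h h1.symm
    · obtain ⟨rfl, ha⟩ := label_eq_iff.1 hg
      refine ⟨g, ⟨lt_of_le_of_ne heg fun h => hq (h ▸ rfl), ?_⟩, hg⟩
      rintro (h | h)
      · exact hq (proc_iff.1 h).1.symm
      · exact hf _ h rfl
    · obtain ⟨h1, ha⟩ := label_eq_iff.1 hg
      have hfg : M.lt f g := lt_of_lt_of_le (lt_of_proc hx) hxg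
      refine ⟨g, ⟨lt_of_lt_of_le (lt_of_msg hef) (le_of_lt hfg), ?_⟩, hg⟩
      rintro (h | h)
      · exact M.msg_ne _ _ hef ((proc_iff.1 h).1.trans h1)
      · obtain rfl := (M.msg_unique _ _ _ _ hef h (Or.inl rfl)).2
        exact lt_irrefl _ hfg
    · obtain ⟨k, hk⟩ := Option.ne_none_iff_exists'.1 hne
      obtain ⟨f', g, h1, h2, h3, h4, rfl⟩ := fwdCut_eq_some.1 hk
      obtain rfl := (M.msg_unique _ _ _ _ hef h1 (Or.inl rfl)).2
      obtain ⟨h5, h6, h7⟩ := prv_spec h4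
      have hlt : (e.2 : ℕ) < M.lcut f.1 u.1 (g.2 + 1) := by
        by_contra! hle
        exact hu ⟨_, hk, hle⟩
      have hle : M.le e g :=
        le_of_lt_lcut (u := u.1) ((congrArg (fun p => pend p u.1) h5).trans h3)
          (hlt.trans_eq (congrArg (fun p => M.lcut p u.1 (g.2 + 1)) h5.symm))
      have hne' : e.1 ≠ g.1 := fun h => M.msg_ne _ _ hef (h.trans h5)
      refine ⟨g, ⟨lt_of_le_of_ne hle fun h => hne' (congrArg Sigma.fst h), ?_⟩,
        label_eq_iff.2 ⟨h5, h7⟩⟩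
      rintro (h | h)
      · exact hne' (proc_iff.1 h).1
      · obtain rfl := (M.msg_unique _ _ _ _ hef h (Or.inl rfl)).2
        exact absurd h6 (Nat.lt_irrefl _)

/-- Paths only lead backwards, so this is not a plain mirror image. Events between the send event
`f` and the past boundary of `e` are detected at `f`: it is compared with the last event of the
given letter before the cut pulled from `e`. -/
theorem mem_type_strictLessInv {e : M.Event} {q : P} {a : A} :
    (q, a) ∈ M.typeOf e .strictLessInv ↔
      (q = e.1 ∧ ∃ x, M.proc x e ∧ (q, a) ∈ M.pastPrev x) ∨
      (q ≠ e.1 ∧ (∀ f, M.msg f e → f.1 ≠ q) ∧ (q, a) ∈ M.past e) ∨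
      ∃ f, M.msg f e ∧ f.1 = q ∧ ((q, a) ∈ M.pastPrev f ∨
        ∃ u : Path P, M.bwdCut (M.HasLetter a) e.1 u.1 f ≠ none ∧
          ¬ ∃ k, M.bwdCut (M.HasLetter a) e.1 u.1 f = some k ∧ k ≤ f.2) := by
  constructor
  · rintro ⟨g, ⟨hlt, hn⟩, hg⟩
    obtain ⟨rfl, ha⟩ := label_eq_iff.1 hg
    push Not at hn
    by_cases hq : g.1 = e.1
    · left
      have h1 := (lt_iff_of_eq hq).1 hlt
      obtain ⟨x, hx, hxg⟩ := exists_proc_of_gt hq h1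
      have h2 := proc_iff.1 hx
      have h3 : (g.2 : ℕ) < x.2 := by
        refine Nat.lt_of_le_of_ne ((le_iff_of_eq (hq.trans h2.1.symm)).1 hxg) fun h => ?_
        exact hn.1 (proc_iff.2 ⟨hq, by rw [h]; exact h2.2⟩)
      obtain ⟨y, hy, hyg⟩ := exists_proc_of_gt (hq.trans h2.1.symm) h3
      exact ⟨hq, x, hx, y, hy, g, hyg, hg⟩
    by_cases hf : ∃ f, M.msg f e ∧ f.1 = g.1
    · right; right
      obtain ⟨f, hef, hfg⟩ := hf
      refine ⟨f, hef, hfg, ?_⟩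
      rcases lt_trichotomy (g.2 : ℕ) f.2 with h | h | h
      · obtain ⟨x, hx, hxg⟩ := exists_proc_of_gt hfg.symm h
        exact Or.inl ⟨x, hx, g, hxg, hg⟩
      · exact absurd hef (event_ext hfg h.symm ▸ hn.2)
      · right
        obtain ⟨u, hu, hlt'⟩ := le_iff_exists_path.1 (le_of_lt hlt)
        obtain ⟨g', hg', hle⟩ := exists_prv ha hlt'
        rw [← hfg] at hg'
        have hk : M.bwdCut (M.HasLetter a) e.1 u.1 f = some (g'.2 : ℕ) :=
          bwdCut_eq_some.2 ⟨e, g', hef, rfl, hu.trans hfg.symm, hg', rfl⟩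
        refine ⟨u, by rw [hk]; exact Option.some_ne_none _, ?_⟩
        rintro ⟨k, hk', hle'⟩
        rw [hk] at hk'
        cases hk'
        omega
    · right; left
      push Not at hf
      exact ⟨hq, hf, g, le_of_lt hlt, hg⟩
  · rintro (⟨rfl, x, hx, y, hy, g, hyg, hg⟩ | ⟨hq, hf, g, heg, hg⟩ |
      ⟨f, hef, rfl, ⟨x, hx, g, hxg, hg⟩ | ⟨u, hne, hu⟩⟩)
    · obtain ⟨h1, ha⟩ := label_eq_iff.1 hg
      have hx' := proc_iff.1 hx
      have hy' := proc_iff.1 hy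
      have := (le_iff_of_eq (h1.trans (hx'.1.symm.trans hy'.1.symm))).1 hyg
      refine ⟨g, ⟨lt_of_pos_lt h1 (by omega), ?_⟩, hg⟩
      rintro (h | h)
      · have := (proc_iff.1 h).2
        omega
      · exact M.msg_ne _ _ h h1
    · obtain ⟨rfl, ha⟩ := label_eq_iff.1 hg
      refine ⟨g, ⟨lt_of_le_of_ne heg fun h => hq (h ▸ rfl), ?_⟩, hg⟩
      rintro (h | h)
      · exact hq (proc_iff.1 h).1
      · exact hf _ h rfl
    · obtain ⟨h1, ha⟩ := label_eq_iff.1 hg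
      have hfg : M.lt g f := lt_of_le_of_lt hxg (lt_of_proc hx)
      refine ⟨g, ⟨lt_of_le_of_lt (le_of_lt hfg) (lt_of_msg hef), ?_⟩, hg⟩
      rintro (h | h)
      · exact M.msg_ne _ _ hef (h1.symm.trans (proc_iff.1 h).1)
      · obtain rfl := (M.msg_unique _ _ _ _ hef h (Or.inr (Or.inr (Or.inr rfl)))).1
        exact lt_irrefl _ hfg
    · obtain ⟨k, hk⟩ := Option.ne_none_iff_exists'.1 hne
      obtain ⟨e', g, h1, h2, h3, h4, rfl⟩ := bwdCut_eq_some.1 hk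
      obtain rfl := (M.msg_unique _ _ _ _ hef h1 (Or.inl rfl)).2
      obtain ⟨h5, h6, h7⟩ := prv_spec h4
      have hlt : (f.2 : ℕ) < g.2 := by
        by_contra! hle
        exact hu ⟨_, hk, hle⟩
      have hle : M.le g e := le_of_lt_lcut (h3.trans h5.symm) h6
      have hne' : g.1 ≠ e.1 := fun h => M.msg_ne _ _ hef (h5.symm.trans h)
      refine ⟨g, ⟨lt_of_le_of_ne hle fun h => hne' (congrArg Sigma.fst h), ?_⟩,
        label_eq_iff.2 ⟨h5, h7⟩⟩
      rintro (h | h)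
      · exact hne' (proc_iff.1 h).1
      · obtain rfl := (M.msg_unique _ _ _ _ hef h (Or.inr (Or.inr (Or.inr rfl)))).1
        exact absurd hlt (Nat.lt_irrefl _)

end MSC

/-! ### The local constraints that determine types -/

open MSC (Path pend)

/-- The data kept at an event: its letter with the guessed type, the labels in its future and its
past, and the comparison tasks. -/
structure Datum (P A : Type u) : Type u where
  letter : A × Types P A
  future : Set (P × A)
  futureNext : Set (P × A)
  past : Set (P × A)
  pastPrev : Set (P × A)
  par : A → P → Path P → Path P → TaskLabel P
  fwd : A → P → Path P → TaskLabel P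
  bwd : A → P → Path P → TaskLabel P

variable {P A : Type u}

/-- The constraints on the guessed type. -/
structure TypeOk (p : P) (d : Datum P A) (prev next : Option (Datum P A))
    (rcv snd : Option (P × Datum P A)) : Prop where
  eq : d.letter.2 .eq = {(p, d.letter.1)}
  proc : d.letter.2 .proc = {l | ∃ x, next = some x ∧ (p, x.letter.1) = l}
  msg : d.letter.2 .msg = {l | ∃ x, rcv = some x ∧ (x.1, x.2.letter.1) = l}
  procInv : d.letter.2 .procInv = {l | ∃ x, prev = some x ∧ (p, x.letter.1) = l}
  msgInv : d.letter.2 .msgInv = {l | ∃ x, snd = some x ∧ (x.1, x.2.letter.1) = l}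
  parallel : ∀ q a, (q, a) ∈ d.letter.2 .parallel ↔ q ≠ p ∧ ∀ v w : Path P, pend q v.1 = p →
    pend p w.1 = q → (d.par a q v w).b
  strictLess : ∀ q a, (q, a) ∈ d.letter.2 .strictLess ↔
    (q = p ∧ ∃ x, next = some x ∧ (q, a) ∈ x.futureNext) ∨
    (q ≠ p ∧ (∀ x, rcv = some x → x.1 ≠ q) ∧ (q, a) ∈ d.future) ∨
    ∃ x, rcv = some x ∧ x.1 = q ∧ ((q, a) ∈ x.2.futureNext ∨
      ∃ u, (d.fwd a q u).y ≠ none ∧ ¬ (d.fwd a q u).b)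
  strictLessInv : ∀ q a, (q, a) ∈ d.letter.2 .strictLessInv ↔
    (q = p ∧ ∃ x, prev = some x ∧ (q, a) ∈ x.pastPrev) ∨
    (q ≠ p ∧ (∀ x, snd = some x → x.1 ≠ q) ∧ (q, a) ∈ d.past) ∨
    ∃ x, snd = some x ∧ x.1 = q ∧ ((q, a) ∈ x.2.pastPrev ∨
      ∃ u, (x.2.bwd a p u).y ≠ none ∧ ¬ (x.2.bwd a p u).b)

/-- The constraints on the labels in the future and in the past. -/
structure ConeOk (p : P) (d : Datum P A) (prev next : Option (Datum P A))
    (rcv snd : Option (P × Datum P A)) : Prop where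
  future : d.future = {l | l = (p, d.letter.1) ∨ l ∈ d.futureNext ∨
    ∃ x, rcv = some x ∧ l ∈ x.2.future}
  futureNext : d.futureNext = {l | ∃ x, next = some x ∧ l ∈ x.future}
  past : d.past = {l | l = (p, d.letter.1) ∨ l ∈ d.pastPrev ∨ ∃ x, snd = some x ∧ l ∈ x.2.past}
  pastPrev : d.pastPrev = {l | ∃ x, prev = some x ∧ l ∈ x.past}

/-- The constraints on the comparison tasks. -/
structure TasksOk (p : P) (d : Datum P A) (prev next : Option (Datum P A))
    (rcv snd : Option (P × Datum P A)) : Prop where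
  par : ∀ a q v w, MSC.ParOk q v w p (d.par a q v w) (prev.map fun x => x.par a q v w)
    (next.map fun x => x.par a q v w) (rcv.map fun x => (x.1, x.2.par a q v w))
    (snd.map fun x => (x.1, x.2.par a q v w))
  par_s : ∀ a q v w, (d.par a q v w).s ↔ d.letter.1 = a
  fwd : ∀ a r u, MSC.FwdOk r u p (d.fwd a r u) (prev.map fun x => x.fwd a r u)
    (next.map fun x => x.fwd a r u) (rcv.map fun x => (x.1, x.2.fwd a r u))
    (snd.map fun x => (x.1, x.2.fwd a r u))
  fwd_s : ∀ a r u, (d.fwd a r u).s ↔ d.letter.1 = a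
  bwd : ∀ a r u, MSC.BwdOk r u p (d.bwd a r u) (prev.map fun x => x.bwd a r u)
    (next.map fun x => x.bwd a r u) (rcv.map fun x => (x.1, x.2.bwd a r u))
    (snd.map fun x => (x.1, x.2.bwd a r u))
  bwd_s : ∀ a r u, (d.bwd a r u).s ↔ d.letter.1 = a

/-- The constraints that force the guessed types to be correct. -/
def typeTiling (P A : Type u) : Tiling P (Datum P A) where
  ok p d prev next rcv snd :=
    TypeOk p d prev next rcv snd ∧ ConeOk p d prev next rcv snd ∧ TasksOk p d prev next rcv snd
  fin s := ∃ G : A → P → Path P → Path P → P → Option Colour, ∀ p,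
    (∀ d, s p = some d → ∀ a q v w, (d.par a q v w).G = G a q v w) ∧
    (s p = none → ∀ a q v w, G a q v w p = none)

/-! ### Soundness and completeness of the type constraints -/

namespace MSC

variable {M : MSC P A} {σ : M.Event → Datum P A}

theorem exists_map_prev {D : Type*} {σ : M.Event → D} {e : M.Event} {Q : D → Prop} :
    (∃ x, (M.prev e).map σ = some x ∧ Q x) ↔ ∃ x, M.proc x e ∧ Q (σ x) := by
  simp only [Option.map_eq_some_iff, prev_eq_some]
  exact ⟨fun ⟨_, ⟨x, h, rfl⟩, h'⟩ => ⟨x, h, h'⟩, fun ⟨x, h, h'⟩ => ⟨_, ⟨x, h, rfl⟩, h'⟩⟩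

theorem exists_map_next {D : Type*} {σ : M.Event → D} {e : M.Event} {Q : D → Prop} :
    (∃ x, (M.next e).map σ = some x ∧ Q x) ↔ ∃ x, M.proc e x ∧ Q (σ x) := by
  simp only [Option.map_eq_some_iff, next_eq_some]
  exact ⟨fun ⟨_, ⟨x, h, rfl⟩, h'⟩ => ⟨x, h, h'⟩, fun ⟨x, h, h'⟩ => ⟨_, ⟨x, h, rfl⟩, h'⟩⟩

theorem exists_map_rcv {D : Type*} {σ : M.Event → D} {e : M.Event} {Q : P × D → Prop} :
    (∃ x, (M.rcv e).map (fun f => (f.1, σ f)) = some x ∧ Q x) ↔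
      ∃ x, M.msg e x ∧ Q (x.1, σ x) := by
  simp only [Option.map_eq_some_iff, rcv_eq_some]
  exact ⟨fun ⟨_, ⟨x, h, rfl⟩, h'⟩ => ⟨x, h, h'⟩, fun ⟨x, h, h'⟩ => ⟨_, ⟨x, h, rfl⟩, h'⟩⟩

theorem exists_map_snd {D : Type*} {σ : M.Event → D} {e : M.Event} {Q : P × D → Prop} :
    (∃ x, (M.snd e).map (fun f => (f.1, σ f)) = some x ∧ Q x) ↔
      ∃ x, M.msg x e ∧ Q (x.1, σ x) := by
  simp only [Option.map_eq_some_iff, snd_eq_some]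
  exact ⟨fun ⟨_, ⟨x, h, rfl⟩, h'⟩ => ⟨x, h, h'⟩, fun ⟨x, h, h'⟩ => ⟨_, ⟨x, h, rfl⟩, h'⟩⟩

theorem forall_map_rcv {D : Type*} {σ : M.Event → D} {e : M.Event} {Q : P × D → Prop} :
    (∀ x, (M.rcv e).map (fun f => (f.1, σ f)) = some x → Q x) ↔
      ∀ x, M.msg e x → Q (x.1, σ x) := by
  simp only [Option.map_eq_some_iff, rcv_eq_some]
  exact ⟨fun h x hx => h _ ⟨x, hx, rfl⟩, fun h _ ⟨x, hx, hx'⟩ => hx' ▸ h x hx⟩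

theorem forall_map_snd {D : Type*} {σ : M.Event → D} {e : M.Event} {Q : P × D → Prop} :
    (∀ x, (M.snd e).map (fun f => (f.1, σ f)) = some x → Q x) ↔
      ∀ x, M.msg x e → Q (x.1, σ x) := by
  simp only [Option.map_eq_some_iff, snd_eq_some]
  exact ⟨fun h x hx => h _ ⟨x, hx, rfl⟩, fun h _ ⟨x, hx, hx'⟩ => hx' ▸ h x hx⟩

/-- The labelling `σ` has the correct futures, pasts and claims. -/
structure Correct (M : MSC P A) (σ : M.Event → Datum P A) : Prop where
  letter : ∀ e, (σ e).letter.1 = M.letterAt e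
  future : ∀ e, (σ e).future = M.future e
  futureNext : ∀ e, (σ e).futureNext = M.futureNext e
  past : ∀ e, (σ e).past = M.past e
  pastPrev : ∀ e, (σ e).pastPrev = M.pastPrev e
  par : ∀ a q v w e, ((σ e).par a q v w).b ↔
    ∃ k, M.parCut (M.HasLetter a) q v.1 w.1 e = some k ∧ k ≤ e.2
  fwd : ∀ a r u e, (((σ e).fwd a r u).y = none ↔ M.fwdCut (M.HasLetter a) r u.1 e = none) ∧
    (((σ e).fwd a r u).b ↔ ∃ k, M.fwdCut (M.HasLetter a) r u.1 e = some k ∧ k ≤ e.2)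
  bwd : ∀ a r u e, (((σ e).bwd a r u).y = none ↔ M.bwdCut (M.HasLetter a) r u.1 e = none) ∧
    (((σ e).bwd a r u).b ↔ ∃ k, M.bwdCut (M.HasLetter a) r u.1 e = some k ∧ k ≤ e.2)

theorem type_proc (e : M.Event) :
    M.typeOf e .proc = {l | ∃ x, M.proc e x ∧ (e.1, M.letterAt x) = l} := by
  ext l
  exact exists_congr fun x => and_congr_right fun h => by
    rw [label, show x.1 = e.1 from (proc_iff.1 h).1.symm]

theorem type_procInv (e : M.Event) :
    M.typeOf e .procInv = {l | ∃ x, M.proc x e ∧ (e.1, M.letterAt x) = l} := by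
  ext l
  exact exists_congr fun x => and_congr_right fun h => by
    rw [label, show x.1 = e.1 from (proc_iff.1 h).1]

theorem type_eq (e : M.Event) : M.typeOf e .eq = {(e.1, M.letterAt e)} := by
  ext l
  constructor
  · rintro ⟨f, rfl, rfl⟩
    rfl
  · rintro rfl
    exact ⟨e, rfl, rfl⟩

theorem lastEvent_eq {e : M.Event} (h : M.next e = none) : M.lastEvent e.1 = some e := by
  rw [next_eq_none] at h
  unfold lastEvent
  rw [dif_pos (by omega)]
  exact congrArg some (event_ext rfl (by simp only; omega))

theorem lastEvent_eq_none {p : P} : M.lastEvent p = none ↔ M.len p = 0 := by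
  unfold lastEvent
  split_ifs with h <;> simp <;> omega

variable [Finite P]

/-- Once the auxiliary data are correct, the constraints restate the characterisations of the eight
components. The two directions serve soundness and completeness of the machine. -/
theorem Correct.typeOk_iff (h : M.Correct σ) (e : M.Event) :
    M.LocalOk TypeOk σ e ↔ (σ e).letter.2 = M.typeOf e := by
  have hpar : ∀ q a, (q, a) ∈ M.typeOf e .parallel ↔ q ≠ e.1 ∧ ∀ v w : Path P,
      pend q v.1 = e.1 → pend e.1 w.1 = q → ((σ e).par a q v w).b := by
    intro q a
    rw [mem_type_parallel]
    simp only [h.par]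
  have hless : ∀ q a, (q, a) ∈ M.typeOf e .strictLess ↔
      (q = e.1 ∧ ∃ x, (M.next e).map σ = some x ∧ (q, a) ∈ x.futureNext) ∨
      (q ≠ e.1 ∧ (∀ x, (M.rcv e).map (fun f => (f.1, σ f)) = some x → x.1 ≠ q) ∧
        (q, a) ∈ (σ e).future) ∨
      ∃ x, (M.rcv e).map (fun f => (f.1, σ f)) = some x ∧ x.1 = q ∧
        ((q, a) ∈ x.2.futureNext ∨
          ∃ u, ((σ e).fwd a q u).y ≠ none ∧ ¬ ((σ e).fwd a q u).b) := by
    intro q a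
    rw [mem_type_strictLess, exists_map_next, exists_map_rcv, forall_map_rcv]
    simp only [h.futureNext, h.future, h.fwd, ne_eq]
  have hlessInv : ∀ q a, (q, a) ∈ M.typeOf e .strictLessInv ↔
      (q = e.1 ∧ ∃ x, (M.prev e).map σ = some x ∧ (q, a) ∈ x.pastPrev) ∨
      (q ≠ e.1 ∧ (∀ x, (M.snd e).map (fun f => (f.1, σ f)) = some x → x.1 ≠ q) ∧
        (q, a) ∈ (σ e).past) ∨
      ∃ x, (M.snd e).map (fun f => (f.1, σ f)) = some x ∧ x.1 = q ∧
        ((q, a) ∈ x.2.pastPrev ∨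
          ∃ u, (x.2.bwd a e.1 u).y ≠ none ∧ ¬ (x.2.bwd a e.1 u).b) := by
    intro q a
    rw [mem_type_strictLessInv, exists_map_prev, exists_map_snd, forall_map_snd]
    simp only [h.pastPrev, h.past, h.bwd, ne_eq]
  have hproc : M.typeOf e .proc =
      {l | ∃ x, (M.next e).map σ = some x ∧ (e.1, x.letter.1) = l} := by
    rw [type_proc]
    simp only [exists_map_next, h.letter]
  have hprocInv : M.typeOf e .procInv =
      {l | ∃ x, (M.prev e).map σ = some x ∧ (e.1, x.letter.1) = l} := by
    rw [type_procInv]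
    simp only [exists_map_prev, h.letter]
  have hmsg : M.typeOf e .msg = {l | ∃ x, (M.rcv e).map (fun f => (f.1, σ f)) = some x ∧
      (x.1, x.2.letter.1) = l} := by
    simp only [exists_map_rcv, h.letter]
    rfl
  have hmsgInv : M.typeOf e .msgInv = {l | ∃ x, (M.snd e).map (fun f => (f.1, σ f)) = some x ∧
      (x.1, x.2.letter.1) = l} := by
    simp only [exists_map_snd, h.letter]
    rfl
  have heq : M.typeOf e .eq = {(e.1, (σ e).letter.1)} := by rw [h.letter, type_eq]
  constructor
  · intro hok
    funext r
    cases r with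
    | eq => exact hok.eq.trans heq.symm
    | proc => exact hok.proc.trans hproc.symm
    | msg => exact hok.msg.trans hmsg.symm
    | parallel => exact Set.ext fun ⟨q, a⟩ => (hok.parallel q a).trans (hpar q a).symm
    | procInv => exact hok.procInv.trans hprocInv.symm
    | msgInv => exact hok.msgInv.trans hmsgInv.symm
    | strictLess => exact Set.ext fun ⟨q, a⟩ => (hok.strictLess q a).trans (hless q a).symm
    | strictLessInv =>
      exact Set.ext fun ⟨q, a⟩ => (hok.strictLessInv q a).trans (hlessInv q a).symm
  · intro ht
    constructor
    · rw [ht]; exact heq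
    · rw [ht]; exact hproc
    · rw [ht]; exact hmsg
    · rw [ht]; exact hprocInv
    · rw [ht]; exact hmsgInv
    · rw [ht]; exact hpar
    · rw [ht]; exact hless
    · rw [ht]; exact hlessInv

/-- The recursions for future and past are well-founded along `>` and `<` respectively, so they have
only the intended solution. -/
theorem cone_correct (hletter : ∀ e, (σ e).letter.1 = M.letterAt e)
    (h : ∀ e, M.LocalOk ConeOk σ e) (e : M.Event) :
    ((σ e).future = M.future e ∧ (σ e).futureNext = M.futureNext e) ∧
      ((σ e).past = M.past e ∧ (σ e).pastPrev = M.pastPrev e) := by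
  constructor
  · induction e using M.gt_wellFounded.induction with
    | _ e ih =>
      have h1 : (σ e).futureNext = M.futureNext e := by
        rw [(h e).futureNext]
        simp only [exists_map_next]
        ext l
        refine exists_congr fun x => and_congr_right fun hx => ?_
        rw [(ih x (lt_of_proc hx)).1]
      refine ⟨?_, h1⟩
      rw [(h e).future, future_eq, h1]
      simp only [exists_map_rcv, hletter]
      ext l
      refine or_congr_right (or_congr_right (exists_congr fun x => and_congr_right fun hx => ?_))
      rw [(ih x (lt_of_msg hx)).1]
  · induction e using M.lt_wellFounded.induction with
    | _ e ih =>
      have h1 : (σ e).pastPrev = M.pastPrev e := by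
        rw [(h e).pastPrev]
        simp only [exists_map_prev]
        ext l
        refine exists_congr fun x => and_congr_right fun hx => ?_
        rw [(ih x (lt_of_proc hx)).1]
      refine ⟨?_, h1⟩
      rw [(h e).past, past_eq, h1]
      simp only [exists_map_snd, hletter]
      ext l
      refine or_congr_right (or_congr_right (exists_congr fun x => and_congr_right fun hx => ?_))
      rw [(ih x (lt_of_msg hx)).1]

theorem correct_of_sat (hletter : ∀ e, (σ e).letter.1 = M.letterAt e)
    (h : (typeTiling P A).Sat M σ) : M.Correct σ := by
  obtain ⟨G, hG⟩ := h.fin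
  have hpar : ∀ a q v w e, M.LocalOk (ParOk q v w) (fun e => (σ e).par a q v w) e := by
    intro a q v w e
    have := (h.ok e).2.2.par a q v w
    simp only [Option.map_map] at this
    exact this
  have hfwd : ∀ a r u e, M.LocalOk (FwdOk r u) (fun e => (σ e).fwd a r u) e := by
    intro a r u e
    have := (h.ok e).2.2.fwd a r u
    simp only [Option.map_map] at this
    exact this
  have hbwd : ∀ a r u e, M.LocalOk (BwdOk r u) (fun e => (σ e).bwd a r u) e := by
    intro a r u e
    have := (h.ok e).2.2.bwd a r u
    simp only [Option.map_map] at this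
    exact this
  -- Acceptance fixes `G` at the last events; constancy carries it back along each process.
  have hG' : ∀ a q v w e, ((σ e).par a q v w).G = G a q v w := by
    intro a q v w e
    induction hm : M.len e.1 - e.2 generalizing e with
    | zero => have := e.2.2; omega
    | succ m ih =>
      cases hx : M.next e with
      | none => exact (hG e.1).1 _ (congrArg (Option.map σ) (lastEvent_eq hx)) a q v w
      | some x =>
        have hx' := next_eq_some.1 hx
        refine ((hpar a q v w x).G_step _ (by rw [prev_eq_some.2 hx']; rfl)).trans (ih x ?_)
        have := congrArg M.len (proc_iff.1 hx').1
        have := (proc_iff.1 hx').2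
        omega
  have hcone := cone_correct hletter fun e => (h.ok e).2.1
  refine ⟨hletter, fun e => (hcone e).1.1, fun e => (hcone e).1.2, fun e => (hcone e).2.1,
    fun e => (hcone e).2.2, fun a q v w e => ?_, fun a r u e => ?_, fun a r u e => ?_⟩
  · refine par_claim_iff (hpar a q v w) (fun e => ?_) (hG' a q v w) (fun p hp => ?_) e
    · exact ((h.ok e).2.2.par_s a q v w).trans (by rw [hletter]; rfl)
    · exact (hG p).2 (congrArg (Option.map σ) (lastEvent_eq_none.2 hp)) a q v w
  · refine fwd_claim_iff (hfwd a r u) (fun e => ?_) e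
    exact ((h.ok e).2.2.fwd_s a r u).trans (by rw [hletter]; rfl)
  · refine bwd_claim_iff (hbwd a r u) (fun e => ?_) e
    exact ((h.ok e).2.2.bwd_s a r u).trans (by rw [hletter]; rfl)

theorem type_of_sat (hletter : ∀ e, (σ e).letter.1 = M.letterAt e)
    (h : (typeTiling P A).Sat M σ) (e : M.Event) : (σ e).letter.2 = M.typeOf e :=
  ((correct_of_sat hletter h).typeOk_iff e).1 (h.ok e).1

theorem exists_sat (M : MSC P A) : ∃ σ : M.Event → Datum P A, (typeTiling P A).Sat M σ ∧
    ∀ e, (σ e).letter = (M.letterAt e, M.typeOf e) := by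
  choose Lp G hLp hsp hGp hG₀ using fun a => exists_parOk (M.HasLetter a)
  choose Lf hLf hsf using fun a => exists_fwdOk (M.HasLetter a)
  choose Lb hLb hsb using fun a => exists_bwdOk (M.HasLetter a)
  let σ : M.Event → Datum P A := fun e =>
    { letter := (M.letterAt e, M.typeOf e)
      future := M.future e
      futureNext := M.futureNext e
      past := M.past e
      pastPrev := M.pastPrev e
      par := fun a q v w => Lp a q v w e
      fwd := fun a r u => Lf a r u e
      bwd := fun a r u => Lb a r u e }
  -- The constructed task labels satisfy their constraints, so the soundness lemmas also prove their
  -- claims correct.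
  have hcorrect : M.Correct σ := ⟨fun _ => rfl, fun _ => rfl, fun _ => rfl, fun _ => rfl,
    fun _ => rfl, fun a q v w e => par_claim_iff (hLp a q v w) (hsp a q v w) (hGp a q v w)
      (hG₀ a q v w) e, fun a r u e => fwd_claim_iff (hLf a r u) (hsf a r u) e,
    fun a r u e => bwd_claim_iff (hLb a r u) (hsb a r u) e⟩
  refine ⟨σ, ⟨fun e => ⟨(hcorrect.typeOk_iff e).2 rfl, ?_, ?_⟩, G, fun p => ⟨?_, ?_⟩⟩,
    fun _ => rfl⟩
  · constructor
    · simp only [exists_map_rcv]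
      exact future_eq e
    · simp only [exists_map_next]
      rfl
    · simp only [exists_map_snd]
      exact past_eq e
    · simp only [exists_map_prev]
      rfl
  · constructor
    · intro a q v w
      simp only [Option.map_map]
      exact hLp a q v w e
    · intro a q v w
      exact hsp a q v w e
    · intro a r u
      simp only [Option.map_map]
      exact hLf a r u e
    · intro a r u
      exact hsf a r u e
    · intro a r u
      simp only [Option.map_map]
      exact hLb a r u e
    · intro a r u
      exact hsb a r u e
  · intro d hd a q v w
    obtain ⟨x, -, rfl⟩ := Option.map_eq_some_iff.1 hd
    exact hGp a q v w x
  · intro hp a q v w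
    exact hG₀ a q v w p (lastEvent_eq_none.1 (Option.map_eq_none_iff.1 hp))

end MSC

theorem language_typeTiling [Finite P] [Finite (Datum P A)] :
    ((typeTiling P A).toCFM Datum.letter).language =
      {N | ∃ M : MSC P A, N = M.extend M.typeOf} := by
  ext N
  constructor
  · intro hN
    obtain ⟨σ, hσ, hletter⟩ := Tiling.exists_sat_of_mem_language hN
    let M : MSC P A :=
      { len := N.len
        letter := fun p i => (N.letter p i).1
        msg := N.msg
        exists_event := N.exists_event
        msg_ne := N.msg_ne
        acyclic := N.acyclic
        msg_unique := N.msg_unique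
        fifo := N.fifo }
    -- The constraints do not read the letters of the MSC, so they pass from `N` to `M`, which
    -- forgets the guessed types.
    have hM : (typeTiling P A).Sat M σ := ⟨hσ.ok, hσ.fin⟩
    have ht := MSC.type_of_sat (M := M) (fun e => congrArg Prod.fst (hletter e)) hM
    refine ⟨M, ?_⟩
    have hl : N.letter = fun p i => ((N.letter p i).1, M.typeOf ⟨p, i⟩) := by
      funext p i
      refine Prod.ext rfl ?_
      rw [← ht]
      exact (congrArg Prod.snd (hletter ⟨p, i⟩)).symm
    change N = MSC.mk N.len (fun p i => ((N.letter p i).1, M.typeOf ⟨p, i⟩)) N.msg _ _ _ _ _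
    rw [← hl]
  · rintro ⟨M, rfl⟩
    obtain ⟨σ, hσ, hletter⟩ := M.exists_sat
    exact Tiling.mem_language_of_sat (M := M.extend M.typeOf) (σ := σ) ⟨hσ.ok, hσ.fin⟩ hletter

/-! ### The number of states -/

open MSC (Path)

/-- The elements of `X` can be encoded by `k` bits. -/
structure Bits (X : Type*) (k : ℕ) : Prop where
  finite : Finite X
  card_le : Nat.card X ≤ 2 ^ k

namespace Bits

variable {X Y : Type*} {k l : ℕ}

theorem mono (h : Bits X k) (hkl : k ≤ l) : Bits X l :=
  ⟨h.finite, h.card_le.trans (Nat.pow_le_pow_right Nat.two_pos hkl)⟩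

theorem prod (hX : Bits X k) (hY : Bits Y l) : Bits (X × Y) (k + l) := by
  have := hX.finite
  have := hY.finite
  refine ⟨inferInstance, ?_⟩
  rw [Nat.card_prod, pow_add]
  exact Nat.mul_le_mul hX.card_le hY.card_le

theorem option (hX : Bits X k) : Bits (Option X) (k + 1) := by
  have := hX.finite
  refine ⟨inferInstance, ?_⟩
  have h1 := hX.card_le
  have h2 := Nat.one_le_two_pow (n := k)
  rw [Finite.card_option, pow_succ]
  omega

theorem fun_of_card_le [Finite X] (hX : Nat.card X ≤ l) (hY : Bits Y k) :
    Bits (X → Y) (l * k) := by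
  have := hY.finite
  refine ⟨inferInstance, ?_⟩
  rw [Nat.card_fun, mul_comm, pow_mul]
  exact (Nat.pow_le_pow_left hY.card_le _).trans
    (Nat.pow_le_pow_right (Nat.two_pow_pos k) hX)

theorem of_injective (hY : Bits Y k) {f : X → Y} (hf : Function.Injective f) : Bits X k := by
  have := hY.finite
  exact ⟨Finite.of_injective f hf, (Nat.card_le_card_of_injective f hf).trans hY.card_le⟩

theorem prop : Bits Prop 1 := ⟨inferInstance, by simp⟩

theorem colour : Bits Colour 2 := ⟨inferInstance, by simp [Colour]⟩

theorem set [Finite X] (hX : Nat.card X ≤ l) : Bits (Set X) l :=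
  (fun_of_card_le hX prop).mono (mul_one l).le

theorem self [Finite X] : Bits X (Nat.card X) := ⟨inferInstance, Nat.lt_two_pow_self.le⟩

end Bits

theorem RelSymbol.exists_surjective : ∃ f : Fin 8 → RelSymbol, Function.Surjective f := by
  refine ⟨![.eq, .proc, .msg, .parallel, .procInv, .msgInv, .strictLess, .strictLessInv],
    fun r => ?_⟩
  cases r
  exacts [⟨0, rfl⟩, ⟨1, rfl⟩, ⟨2, rfl⟩, ⟨3, rfl⟩, ⟨4, rfl⟩, ⟨5, rfl⟩, ⟨6, rfl⟩, ⟨7, rfl⟩]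

section Card

variable (P A : Type u) [Finite P] [Finite A]

instance MSC.finite_path : Finite (Path P) := (List.finite_length_le P (Nat.card P)).to_subtype

/-- A path is padded with `none` to a word of length `n` over `n + 1` symbols. -/
theorem MSC.card_path_le : Nat.card (Path P) ≤ (Nat.card P + 1) ^ Nat.card P := by
  have h : Function.Injective fun (u : Path P) (i : Fin (Nat.card P)) => u.1[(i : ℕ)]? := by
    rintro ⟨u, hu⟩ ⟨v, hv⟩ huv
    refine Subtype.ext (List.ext_getElem? fun i => ?_)
    by_cases hi : i < Nat.card P
    · exact congrFun huv ⟨i, hi⟩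
    · rw [List.getElem?_eq_none (by simp only; omega), List.getElem?_eq_none (by simp only; omega)]
  refine (Nat.card_le_card_of_injective _ h).trans ?_
  rw [Nat.card_fun, Finite.card_option, Nat.card_fin]

theorem bits_taskLabel {m : ℕ} (hm : 1 ≤ m) (hP : Nat.card P ≤ m) (hpath : Nat.card (Path P) ≤ m) :
    Bits (TaskLabel P) (20 * m) := by
  have h := Bits.prop.prod <| Bits.colour.prod <| Bits.colour.prod <| Bits.prop.prod <|
    Bits.colour.option.prod <| (Bits.fun_of_card_le hpath Bits.colour).prod <|
    Bits.colour.option.prod <| (Bits.fun_of_card_le hpath Bits.colour.option).prod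
    (Bits.fun_of_card_le hP Bits.colour.option)
  -- The fields take `12 + 8 * m` bits.
  refine (h.of_injective (f := fun l : TaskLabel P =>
    (l.s, l.d, l.c, l.b, l.y, l.V, l.X, l.Z, l.G)) ?_).mono (by omega)
  rintro ⟨⟩ ⟨⟩ h
  simp only [Prod.mk.injEq] at h
  simp only [h]

theorem bits_types {m : ℕ} (hP : Nat.card P ≤ m) :
    Bits (Types P A) (8 * (m * Nat.card A)) := by
  obtain ⟨f, hf⟩ := RelSymbol.exists_surjective
  have : Finite RelSymbol := Finite.of_surjective f hf
  refine Bits.fun_of_card_le ((Nat.card_le_card_of_surjective f hf).trans (by simp)) (Bits.set ?_)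
  rw [Nat.card_prod]
  exact Nat.mul_le_mul_right _ hP

theorem bits_datum {m : ℕ} (hm : 1 ≤ m) (hP : Nat.card P ≤ m) (hpath : Nat.card (Path P) ≤ m) :
    Bits (Datum P A) (73 * (Nat.card A * m ^ 4)) := by
  have hset : Bits (Set (P × A)) (m * Nat.card A) := Bits.set (by
    rw [Nat.card_prod]
    exact Nat.mul_le_mul_right _ hP)
  have htask := bits_taskLabel P hm hP hpath
  have h1 := Bits.fun_of_card_le (le_refl (Nat.card A)) <| Bits.fun_of_card_le hP <|
    Bits.fun_of_card_le hpath htask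
  have h2 := Bits.fun_of_card_le (le_refl (Nat.card A)) <| Bits.fun_of_card_le hP <|
    Bits.fun_of_card_le hpath <| Bits.fun_of_card_le hpath htask
  have h := ((Bits.self (X := A)).prod (bits_types P A hP)).prod <| hset.prod <| hset.prod <|
    hset.prod <| hset.prod <| h2.prod <| h1.prod h1
  -- In units of `|A| * m ^ 4`: 1 for the letter, 8 for the type, 4 for the cones and 20 for each of
  -- the three families of tasks.
  refine (h.of_injective (f := fun d : Datum P A =>
    (d.letter, d.future, d.futureNext, d.past, d.pastPrev, d.par, d.fwd, d.bwd)) ?_).mono ?_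
  · rintro ⟨⟩ ⟨⟩ h
    simp only [Prod.mk.injEq] at h
    simp only [h]
  · generalize Nat.card A = a
    have e1 : a ≤ a * m ^ 4 := Nat.le_mul_of_pos_right _ (Nat.pow_pos hm)
    have e2 : m * a ≤ a * m ^ 4 := by
      rw [mul_comm]
      exact Nat.mul_le_mul_left _ (Nat.le_self_pow (by norm_num) m)
    have e3 : a * m ^ 3 ≤ a * m ^ 4 :=
      Nat.mul_le_mul_left _ (Nat.pow_le_pow_right hm (by norm_num))
    have e4 : a * (m * (m * (20 * m))) = 20 * (a * m ^ 3) := by ring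
    have e5 : a * (m * (m * (m * (20 * m)))) = 20 * (a * m ^ 4) := by ring
    rw [e4, e5]
    omega

instance : Finite (Datum P A) := by
  have h1 : Nat.card P ≤ Nat.card P + Nat.card (Path P) + 1 := by omega
  have h2 : Nat.card (Path P) ≤ Nat.card P + Nat.card (Path P) + 1 := by omega
  exact (bits_datum P A (by omega) h1 h2).finite

/-- The exponent in the bound on the number of states. -/
def stateExponent (n : ℕ) : ℕ := 8 + 4 * n * (Nat.log 2 (n + 1) + 1)

theorem card_state_le [Nonempty A] (p : P) :
    Nat.card (((typeTiling P A).toCFM Datum.letter).State p) ≤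
      2 ^ (Nat.card A * 2 ^ stateExponent (Nat.card P)) := by
  have hpath := MSC.card_path_le P
  set n := Nat.card P with hn
  have hm : 1 ≤ (n + 1) ^ n := Nat.one_le_pow _ _ (Nat.succ_pos n)
  have hP : n ≤ (n + 1) ^ n := by
    rcases Nat.eq_zero_or_pos n with h | h
    · omega
    · exact n.le_succ.trans (Nat.le_self_pow h.ne' _)
  have h := bits_datum P A hm hP hpath
  -- With `N = |A| * m ^ 4 ≥ 1` and `m = (n + 1) ^ n`, a state takes `146 * N + 2 ≤ 2 ^ 8 * N` bits.
  refine ((h.prod h.option).option.mono ?_).card_le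
  have hA : 1 ≤ Nat.card A := Nat.card_pos
  have h1 : 1 ≤ Nat.card A * ((n + 1) ^ n) ^ 4 := Nat.mul_pos hA (Nat.pow_pos hm)
  have h2 : ((n + 1) ^ n) ^ 4 * 2 ^ 8 ≤ 2 ^ stateExponent n := by
    rw [stateExponent, pow_add, ← pow_mul, mul_comm n 4, mul_comm (4 * n), pow_mul 2, mul_comm]
    exact Nat.mul_le_mul_left _
      (Nat.pow_le_pow_left (Nat.lt_pow_succ_log_self Nat.one_lt_two _).le _)
  have h3 := Nat.mul_le_mul_left (Nat.card A) h2
  rw [← mul_assoc] at h3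
  omega

end Card

/-! ### Growth of the exponent and conclusion -/

theorem stateExponent_isBigO :
    Asymptotics.IsBigO Filter.atTop (fun n : ℕ => (stateExponent n : ℝ))
      (fun n : ℕ => (n : ℝ) * Real.log (n : ℝ)) := by
  -- For `n ≥ 2`, `Nat.log 2 (n + 1) + 1 ≤ 6 * log n` gives `24`, and the summand `8` is at most `8
  -- * n * log n`.
  refine Asymptotics.IsBigO.of_bound 32 ?_
  filter_upwards [Filter.eventually_ge_atTop 2] with n hn
  have hn' : (2 : ℝ) ≤ n := by exact_mod_cast hn
  have hlog2 : (1 / 2 : ℝ) ≤ Real.log 2 := by linarith [Real.log_two_gt_d9]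
  have hlog : Real.log 2 ≤ Real.log n := Real.log_le_log two_pos hn'
  have h1 : (Nat.log 2 (n + 1) : ℝ) * Real.log 2 ≤ 2 * Real.log n := by
    rw [← Real.log_pow, ← Nat.cast_ofNat (n := 2), ← Real.log_pow]
    refine Real.log_le_log (by positivity) ?_
    have h2 : 2 ^ Nat.log 2 (n + 1) ≤ n + 1 := Nat.pow_log_le_self 2 (Nat.succ_ne_zero n)
    have h3 : n + 1 ≤ n ^ 2 := by nlinarith
    exact_mod_cast h2.trans h3
  have h2 : (Nat.log 2 (n + 1) : ℝ) ≤ 4 * Real.log n := by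
    have : (0 : ℝ) ≤ Nat.log 2 (n + 1) := Nat.cast_nonneg _
    nlinarith
  have h3 : (1 : ℝ) ≤ n * Real.log n := by nlinarith
  rw [Real.norm_of_nonneg (Nat.cast_nonneg _), Real.norm_of_nonneg (by linarith), stateExponent]
  push_cast
  have h4 : (n : ℝ) * (Nat.log 2 (n + 1) + 1) ≤ n * (6 * Real.log n) :=
    mul_le_mul_of_nonneg_left (by linarith) (by linarith)
  linarith

theorem mainTheorem3 :
    ∃ f : ℕ → ℕ,
      Asymptotics.IsBigO Filter.atTop (fun n : ℕ => (f n : ℝ))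
        (fun n : ℕ => (n : ℝ) * Real.log (n : ℝ)) ∧
      ∀ (P A : Type u) [Finite P] [Finite A],
        ∃ 𝒜 : CFM P (A × Types P A),
          (∀ p : P, Nat.card (𝒜.State p) ≤ 2 ^ (Nat.card A * 2 ^ f (Nat.card P))) ∧
          𝒜.language = {N | ∃ M : MSC P A, N = M.extend M.typeOf} := by
  refine ⟨stateExponent, stateExponent_isBigO, fun P A _ _ => ?_⟩
  rcases isEmpty_or_nonempty A with hA | hA
  -- Over an empty alphabet there are no MSCs, and the bound allows only one state.
  · refine ⟨⟨PUnit, inferInstance, fun _ => PUnit, fun _ => inferInstance, fun _ => ⟨⟩,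
      fun _ => ∅, ∅⟩, fun p => ?_, ?_⟩
    · rw [Nat.card_unique]
      exact Nat.one_le_two_pow
    · ext N
      obtain ⟨p, hp⟩ := N.exists_event
      exact isEmptyElim (N.letter p ⟨0, hp⟩).1
  · exact ⟨(typeTiling P A).toCFM Datum.letter, card_state_le P A, language_typeTiling⟩
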